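/- Throughout, Hilbert spaces are complex, and a unital C*-algebra $\mathfrak A\subset\mathcal B(\mathcal H)$ is a norm closed $*$-subalgebra containing the identity operator. A map on a von Neumann algebra is normal if it preserves suprema of bounded increasing nets of self-adjoint elements. Let $\mathcal H$ be a Hilbert space, $\mathfrak A\subset\mathcal B(\mathcal H)$ a unital C*-algebra and $\Phi:\mathfrak A\to\mathfrak A$ a unital completely positive map. Then the following exist. (a) A Hilbert space $\mathcal H_\infty$, a faithful unital representation $\pi:\mathfrak A\to\mathcal B(\mathcal H_\infty)$ and an isometry $V$ on $\mathcal H_\infty$ with $V^*\pi(a)V=\pi(\Phi(a))$ for all $a\in\mathfrak A$. They form the iterated Stinespring representation of $\Phi$: $\mathcal H_\infty=\bigoplus_{n\ge 0}\mathcal H_n$ with each $\mathcal H_n$ invariant under $\pi(\mathfrak A)$; $\mathcal H_0=\mathcal H$ with $\pi(a)|_{\mathcal H_0}=a$; $V\mathcal H_n\subset\mathcal H_{n+1}$; and $\mathcal H_{n+1}$ is the closed linear span of $\pi(\mathfrak A)V\mathcal H_n$. (b) A minimal unitary dilation $(\widehat V,\widehat{\mathcal H},Z)$ of $V$: a Hilbert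 space $\widehat{\mathcal H}$, a unitary $\widehat V$ on $\widehat{\mathcal H}$ and an isometry $Z:\mathcal H_\infty\to\widehat{\mathcal H}$ such that $\widehat V^nZ=ZV^n$ for all $n\ge0$ and $\widehat{\mathcal H}$ is the closed linear span of $\bigcup_{k\in\mathbb Z}\widehat V^kZ\mathcal H_\infty$. (c) A unital C*-algebra $\widehat{\mathfrak A}\subset\mathcal B(\widehat{\mathcal H})$ such that $\widehat\Phi(X)=\widehat V^*X\widehat V$ defines a unital $*$-endomorphism $\widehat\Phi:\widehat{\mathfrak A}\to\widehat{\mathfrak A}$, and such that, identifying $\mathfrak A$ with $\pi(\mathfrak A)$ through $\pi$ (so that $\Phi$ acts on $\pi(\mathfrak A)$ by $\pi(a)\mapsto\pi(\Phi(a))$), $$Z\mathfrak AZ^*\subset\widehat{\mathfrak A},\qquad Z^*\widehat{\mathfrak A}Z\subset\mathfrak A,$$ $$\Phi^n(A)=Z^*\widehat\Phi^n(ZAZ^*)Z,\qquad Z^*\widehat\Phi^n(X)Z=\Phi^n(Z^*XZ)$$ for all $A\in\mathfrak A$, $X\in\widehat{\mathfrak A}$ and $n\ge0$. If moreover $\mathfrak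 A$ is a von Neumann algebra on $\mathcal H$ and $\Phi$ is normal, then there exist objects as in (a), (b), (c) such that in addition $\pi$ is normal, $\widehat{\mathfrak A}$ is a von Neumann algebra on $\widehat{\mathcal H}$, and $\widehat\Phi$ is normal. -/

import Mathlib

open scoped CStarAlgebra InnerProductSpace

universe u

namespace UcpDilation

/-- A norm closed unital *-subalgebra of `B(H)`, with the order inherited from `B(H)`, is a star
ordered ring; this makes completely positive maps between concrete C*-algebras available. -/
instance instStarOrderedRingSubalgebra {H : Type*} [NormedAddCommGroup H] [InnerProductSpace ℂ H]
    [CompleteSpace H] (A : StarSubalgebra ℂ (H →L[ℂ] H)) [IsClosed (A : Set (H →L[ℂ] H))] :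
    StarOrderedRing A := by
  refine StarOrderedRing.of_nonneg_iff' (fun {x y} hxy z => ?_) (fun x => ⟨fun hx => ?_, ?_⟩)
  · exact add_le_add_right (a := (z : H →L[ℂ] H)) (show (x : H →L[ℂ] H) ≤ y from hxy)
  · have hx' : (0 : H →L[ℂ] H) ≤ x := hx
    have hsa : IsSelfAdjoint x := Subtype.ext (IsSelfAdjoint.of_nonneg hx').star_eq
    have hsp : SpectrumRestricts x ContinuousMap.realToNNReal := by
      rw [SpectrumRestricts.nnreal_iff]
      intro r hr
      refine spectrum_nonneg_of_nonneg hx' (x := r) ?_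
      rw [← spectrum.preimage_algebraMap ℂ, Set.mem_preimage] at hr ⊢
      rwa [← StarSubalgebra.spectrum_eq (S := A)]
    obtain ⟨s, hs, -, h⟩ := CFC.exists_sqrt_of_isSelfAdjoint_of_quasispectrumRestricts hsa hsp
    exact ⟨s, by rw [hs.star_eq, h]⟩
  · rintro ⟨s, rfl⟩
    exact star_mul_self_nonneg (s : H →L[ℂ] H)

/-- A von Neumann algebra is norm closed, hence a unital C*-algebra. -/
instance instIsClosedVonNeumannAlgebra {H : Type*} [NormedAddCommGroup H] [InnerProductSpace ℂ H]
    [CompleteSpace H] (M : VonNeumannAlgebra H) :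
    IsClosed (M.toStarSubalgebra : Set (H →L[ℂ] H)) := by
  rw [VonNeumannAlgebra.coe_toStarSubalgebra, ← M.centralizer_centralizer]
  exact Set.isClosed_centralizer _

section Isometries

variable {H K : Type*} [NormedAddCommGroup H] [InnerProductSpace ℂ H] [CompleteSpace H]
  [NormedAddCommGroup K] [InnerProductSpace ℂ K] [CompleteSpace K]

/-- The compression `Z* X Z` of an operator `X` along an isometry `Z : H → K`. -/
noncomputable def compress (Z : H →ₗᵢ[ℂ] K) (X : K →L[ℂ] K) : H →L[ℂ] H :=
  (ContinuousLinearMap.adjoint Z.toContinuousLinearMap) ∘L X ∘L Z.toContinuousLinearMap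

/-- The operator `Z T Z*` on `K` for an operator `T` on `H` and an isometry `Z : H → K`. -/
noncomputable def inflate (Z : H →ₗᵢ[ℂ] K) (T : H →L[ℂ] H) : K →L[ℂ] K :=
  Z.toContinuousLinearMap ∘L T ∘L (ContinuousLinearMap.adjoint Z.toContinuousLinearMap)

/-- `(U, K, Z)` is a minimal unitary dilation of the isometry `V` of `H`: `Uⁿ Z = Z Vⁿ` for all
`n ≥ 0`, and the subspaces `Uᵏ Z H`, `k ∈ ℤ`, span a dense subspace of `K`. -/
structure IsMinimalUnitaryDilation (V : H →ₗᵢ[ℂ] H) (U : unitary (K →L[ℂ] K))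
    (Z : H →ₗᵢ[ℂ] K) : Prop where
  intertwines : ∀ (n : ℕ) (x : H), ((U : K →L[ℂ] K) ^ n) (Z x) = Z (V^[n] x)
  minimal : (Submodule.span ℂ
      {y : K | ∃ (k : ℤ) (x : H), y = ((U ^ k : unitary (K →L[ℂ] K)) : K →L[ℂ] K) (Z x)}
    ).topologicalClosure = ⊤

end Isometries

/-- A map `f` from a concrete algebra `A ⊆ B(H)` to `B(K)` is normal if it preserves suprema of
bounded increasing nets of self-adjoint elements of `A` (here: of nonempty upward directed sets of
self-adjoint elements; suprema are taken in `B(H)` and `B(K)`). It is only used for von Neumann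
algebras `A`, where such suprema in `A` and in `B(H)` agree. -/
def IsNormalMap {H K : Type*} [NormedAddCommGroup H] [InnerProductSpace ℂ H] [CompleteSpace H]
    [NormedAddCommGroup K] [InnerProductSpace ℂ K] [CompleteSpace K]
    {A : StarSubalgebra ℂ (H →L[ℂ] H)} (f : A → (K →L[ℂ] K)) : Prop :=
  ∀ (S : Set A) (a : A), S.Nonempty → DirectedOn (· ≤ ·) S → (∀ s ∈ S, IsSelfAdjoint s) →
    IsLUB ((fun s : A => (s : H →L[ℂ] H)) '' S) (a : H →L[ℂ] H) → IsLUB (f '' S) (f a)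

section Dilations

variable {H K L : Type*} [NormedAddCommGroup H] [InnerProductSpace ℂ H] [CompleteSpace H]
  [NormedAddCommGroup K] [InnerProductSpace ℂ K] [CompleteSpace K]
  [NormedAddCommGroup L] [InnerProductSpace ℂ L] [CompleteSpace L]

/-- `(π, K, V)` is the iterated Stinespring representation of the map `Φ` on `A ⊆ B(H)`, written
through its internal direct sum decomposition: `K` is the Hilbert sum of `π`-reducing subspaces
`E 0, E 1, …`; the space `E 0` is (via `j`) the space `H` with the identity representation of `A`;
the isometry `V` maps `E n` into `E (n + 1)` and `V* π(a) V = π(Φ a)`; and `E (n + 1)` is the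
closed linear span of `π(A) V (E n)`, so that `V : E n → E (n + 1)` with `π` on `E (n + 1)` is the
(minimal) Stinespring dilation of `a ↦ π(Φ a)` on `E n`. -/
structure IsStinespringRepresentation (A : StarSubalgebra ℂ (H →L[ℂ] H)) (Φ : A → A)
    (π : A →⋆ₐ[ℂ] (K →L[ℂ] K)) (V : K →ₗᵢ[ℂ] K) (E : ℕ → Submodule ℂ K) (j : H →ₗᵢ[ℂ] K) :
    Prop where
  covariant : ∀ a : A, compress V (π a) = π (Φ a)
  isHilbertSum : IsHilbertSum ℂ (fun n => E n) (fun n => (E n).subtypeₗᵢ)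
  reducing : ∀ (n : ℕ) (a : A), ∀ x ∈ E n, π a x ∈ E n
  range_zero : LinearMap.range j.toLinearMap = E 0
  apply_zero : ∀ (a : A) (x : H), π a (j x) = j ((a : H →L[ℂ] H) x)
  shift : ∀ (n : ℕ), ∀ x ∈ E n, V x ∈ E (n + 1)
  minimal : ∀ n : ℕ, (Submodule.span ℂ {y : K | ∃ a : A, ∃ x ∈ E n, y = π a (V x)}
    ).topologicalClosure = E (n + 1)

/-- Let `π` be a (faithful) representation of `A` on `K`, through which `A` is identified with
`π(A)`. The *-endomorphism `Θ` of `B ⊆ B(L)` together with the isometry `Z : K → L` is a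
multiplicative dilation of `Φ : A → A` if `Z A Z* ⊆ B`, `Z* B Z ⊆ A`,
`Φⁿ(a) = Z* Θⁿ(Z a Z*) Z` and `Z* Θⁿ(X) Z = Φⁿ(Z* X Z)`. -/
structure IsMultiplicativeDilation {A : StarSubalgebra ℂ (H →L[ℂ] H)} (Φ : A → A)
    (π : A →⋆ₐ[ℂ] (K →L[ℂ] K)) {B : StarSubalgebra ℂ (L →L[ℂ] L)} (Θ : B →⋆ₐ[ℂ] B)
    (Z : K →ₗᵢ[ℂ] L) : Prop where
  inflate_mem : ∀ a : A, inflate Z (π a) ∈ B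
  compress_mem : ∀ X : B, compress Z X ∈ π.range
  map_iterate : ∀ (n : ℕ) (a : A),
    π (Φ^[n] a) = compress Z (Θ^[n] ⟨inflate Z (π a), inflate_mem a⟩ : B)
  compress_iterate : ∀ (n : ℕ) (X : B) (a : A), compress Z X = π a →
    compress Z (Θ^[n] X : B) = π (Φ^[n] a)

end Dilations

end UcpDilation

-- Both spaces come from Kolmogorov decompositions of positive definite operator kernels
-- (`exists_kolmogorov_decomposition`). For the iterated Stinespring representation the index set is
-- the words over `A`: the vector `γ [a₁, …, aₙ] x` stands for π(a₁)Vπ(a₂)V⋯π(aₙ)V x. Covariance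
-- V*π(a)V = π(Φ(a)) forces the inner products of such vectors, and `wordKernel` is the result;
-- complete positivity of Φ makes it positive definite (`re_sum_inner_wordKernel_nonneg`). For the
-- unitary dilation the index set is ℤ, `γ n x` stands for Uⁿ Z x, and the kernel is `toeplitz`.
--
-- The dilated algebra is generated by the operators U⁻ⁿ Z π(a) Z* Uⁿ with n ≥ 0. Conjugation X ↦ U*
-- X U raises n by one, so it preserves this algebra. The main point is that compression by Z lands
-- in π(A) (`compress_mem_range`). The span of the operators U⁻ⁿ Z w, with w a product
-- π(a₀)Vπ(a₁)⋯Vπ(aₙ) containing exactly n factors V, is invariant under all generators and contains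
-- Z; applying Z* to it leaves only products with no V at all. Since U Z = Z V, compression
-- intertwines conjugation by U with Φ, which gives both iteration formulas. In the C*-case the
-- compression property passes to the norm closure because π is isometric, so its range is closed.
--
-- In the normal case π is normal, by induction over the summands, and the algebra is replaced by
-- its double commutant. A two-vector density theorem shows that compression maps it into π(A)''. It
-- remains to see π(A)'' = π(A) (`mem_range_of_mem_centralizer_centralizer`). An operator T in
-- π(A)'' agrees with π(j* T j) on the copy of H, and an element of π(A)'' vanishing on that copy is
-- zero. The latter is an exhaustion argument: Zorn's lemma together with local domination of the
-- vector functionals of π by vector functionals on H (`exists_dominated`).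

universe v w

namespace UcpDilation

/-! ### Kolmogorov decompositions and extension of maps from total families -/

section Kernels

variable {X : Type*} {V G G' : Type*} [NormedAddCommGroup V] [InnerProductSpace ℂ V]
  [NormedAddCommGroup G] [InnerProductSpace ℂ G] [NormedAddCommGroup G'] [InnerProductSpace ℂ G']

open ContinuousLinearMap

/-- Kolmogorov decomposition of a positive definite operator valued kernel. -/
theorem exists_kolmogorov_decomposition {X : Type v} {V : Type w} [NormedAddCommGroup V]
    [InnerProductSpace ℂ V] [CompleteSpace V] (k : X → X → V →L[ℂ] V)
    (hk : ∀ x y, adjoint (k x y) = k y x)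
    (hpos : ∀ f : X →₀ V, 0 ≤ (∑ x ∈ f.support, ∑ y ∈ f.support, ⟪k y x (f x), f y⟫_ℂ).re) :
    ∃ (G : Type (max v w)) (_ : NormedAddCommGroup G) (_ : InnerProductSpace ℂ G)
      (_ : CompleteSpace G) (γ : X → V →L[ℂ] G),
      (∀ x y v w, ⟪γ x v, γ y w⟫_ℂ = ⟪k y x v, w⟫_ℂ) ∧
      (Submodule.span ℂ {g | ∃ x v, γ x v = g}).topologicalClosure = ⊤ := by
  let K : Matrix X X (V →L[ℂ] V) := Matrix.of k
  have hherm : K.IsHermitian := by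
    ext1 x y
    exact hk y x
  have hK : K.PosSemidef := by
    have h := (RKHS.posSemidef_tfae (K := K)).out 2 0
    exact h.mp ⟨hherm, hpos⟩
  have : Fact K.PosSemidef := ⟨hK⟩
  refine ⟨RKHS.OfKernel K, inferInstance, inferInstance, inferInstance,
    RKHS.kerFun (RKHS.OfKernel K), fun x y v w => ?_, RKHS.kerFun_dense _⟩
  rw [← RKHS.kernel_inner, RKHS.OfKernel.kernel_ofKernel]
  rfl

/-- The linear map `f ↦ ∑ γ x (f x)` attached to a family of operators. -/
noncomputable def sumMap (γ : X → V →L[ℂ] G) : (X →₀ V) →ₗ[ℂ] G :=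
  Finsupp.lsum ℂ fun x => (γ x : V →ₗ[ℂ] G)

theorem sumMap_single (γ : X → V →L[ℂ] G) (x : X) (v : V) :
    sumMap γ (Finsupp.single x v) = γ x v := by
  simp [sumMap]

theorem sumMap_apply (γ : X → V →L[ℂ] G) (f : X →₀ V) :
    sumMap γ f = ∑ x ∈ f.support, γ x (f x) := by
  simp [sumMap, Finsupp.sum]

theorem inner_sumMap (γ : X → V →L[ℂ] G) (f g : X →₀ V) :
    ⟪sumMap γ f, sumMap γ g⟫_ℂ = ∑ x ∈ f.support, ∑ y ∈ g.support, ⟪γ x (f x), γ y (g y)⟫_ℂ := by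
  simp only [sumMap_apply, sum_inner, inner_sum]
  rw [Finset.sum_comm]

theorem denseRange_sumMap {γ : X → V →L[ℂ] G}
    (hγ : (Submodule.span ℂ {g | ∃ x v, γ x v = g}).topologicalClosure = ⊤) :
    DenseRange (sumMap γ) := by
  have h : Submodule.span ℂ {g | ∃ x v, γ x v = g} ≤ LinearMap.range (sumMap γ) := by
    rw [Submodule.span_le]
    rintro _ ⟨x, v, rfl⟩
    exact ⟨Finsupp.single x v, sumMap_single γ x v⟩
  rw [← Submodule.dense_iff_topologicalClosure_eq_top] at hγ
  exact hγ.mono h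

theorem exists_extension [CompleteSpace G'] {γ : X → V →L[ℂ] G}
    (hγ : (Submodule.span ℂ {g | ∃ x v, γ x v = g}).topologicalClosure = ⊤)
    (δ : X → V →L[ℂ] G') (C : ℝ) (hδ : ∀ f, ‖sumMap δ f‖ ≤ C * ‖sumMap γ f‖) :
    ∃ T : G →L[ℂ] G', ∀ x v, T (γ x v) = δ x v := by
  let T := (sumMap δ).extendOfNorm (sumMap γ)
  refine ⟨T, fun x v => ?_⟩
  have := LinearMap.extendOfNorm_eq (f := sumMap δ) (e := sumMap γ) (denseRange_sumMap hγ) ⟨C, hδ⟩ (Finsupp.single x v)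
  rwa [sumMap_single, sumMap_single] at this

theorem exists_linearIsometry [CompleteSpace G'] {γ : X → V →L[ℂ] G}
    (hγ : (Submodule.span ℂ {g | ∃ x v, γ x v = g}).topologicalClosure = ⊤)
    (δ : X → V →L[ℂ] G') (hδ : ∀ x y v w, ⟪δ x v, δ y w⟫_ℂ = ⟪γ x v, γ y w⟫_ℂ) :
    ∃ T : G →ₗᵢ[ℂ] G', ∀ x v, T (γ x v) = δ x v := by
  have h : ∀ f, ‖sumMap δ f‖ = ‖sumMap γ f‖ := fun f => by
    rw [← sq_eq_sq₀ (norm_nonneg _) (norm_nonneg _), ← inner_self_eq_norm_sq (𝕜 := ℂ),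
      ← inner_self_eq_norm_sq (𝕜 := ℂ), inner_sumMap, inner_sumMap]
    simp only [hδ]
  obtain ⟨T, hT⟩ := exists_extension hγ δ 1 (fun f => by rw [h, one_mul])
  have hT' : ∀ f, T (sumMap γ f) = sumMap δ f := fun f => by
    simp [sumMap_apply, hT]
  refine ⟨⟨T.toLinearMap, fun g => ?_⟩, hT⟩
  refine (denseRange_sumMap hγ).induction_on (p := fun g => ‖T g‖ = ‖g‖) g ?_ fun f => ?_
  · exact isClosed_eq (by fun_prop) (by fun_prop)
  · rw [hT', h]

theorem ext_of_total {γ : X → V →L[ℂ] G}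
    (hγ : (Submodule.span ℂ {g | ∃ x v, γ x v = g}).topologicalClosure = ⊤)
    {S T : G →L[ℂ] G'} (h : ∀ x v, S (γ x v) = T (γ x v)) : S = T := by
  refine DFunLike.coe_injective ((denseRange_sumMap hγ).equalizer S.continuous T.continuous ?_)
  funext f
  simp [sumMap_apply, h]

end Kernels

/-! ### Algebra of the kernel on words -/

section WordKernel

variable {A : Type*} [CStarAlgebra A] [PartialOrder A] [StarOrderedRing A]

/-- The kernel on words over `A` attached to a map `Φ`; the middle argument is a coefficient
that is absorbed from the outside to the inside of the two words. -/
def wordKernel (Φ : A → A) : List A → A → List A → A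
  | [], c, [] => c
  | a :: w, c, b :: w' => wordKernel Φ w (Φ (star a * c * b)) w'
  | [], _, _ :: _ => 0
  | _ :: _, _, [] => 0

variable (Φ : A →CP A)

theorem wordKernel_add : ∀ (w : List A) (c d : A) (w' : List A),
    wordKernel Φ w (c + d) w' = wordKernel Φ w c w' + wordKernel Φ w d w'
  | [], _, _, [] => rfl
  | a :: w, c, d, b :: w' => by
    simp only [wordKernel, mul_add, add_mul, map_add, wordKernel_add w]
  | [], _, _, _ :: _ => (add_zero 0).symm
  | _ :: _, _, _, [] => (add_zero 0).symm

theorem wordKernel_smul : ∀ (w : List A) (r : ℂ) (c : A) (w' : List A),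
    wordKernel Φ w (r • c) w' = r • wordKernel Φ w c w'
  | [], _, _, [] => rfl
  | a :: w, c, d, b :: w' => by
    simp only [wordKernel, mul_smul_comm, smul_mul_assoc, map_smul, wordKernel_smul w]
  | [], _, _, _ :: _ => (smul_zero _).symm
  | _ :: _, _, _, [] => (smul_zero _).symm

theorem wordKernel_zero (w w' : List A) : wordKernel Φ w 0 w' = 0 := by
  simpa using wordKernel_smul Φ w 0 0 w'

theorem star_wordKernel : ∀ (w : List A) (c : A) (w' : List A),
    star (wordKernel Φ w c w') = wordKernel Φ w' (star c) w
  | [], _, [] => rfl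
  | a :: w, c, b :: w' => by
    simp only [wordKernel, star_wordKernel w, ← map_star, star_mul, star_star, mul_assoc]
  | [], _, _ :: _ => star_zero _
  | _ :: _, _, [] => star_zero _

theorem wordKernel_of_length_ne : ∀ (w : List A) (c : A) (w' : List A), w.length ≠ w'.length →
    wordKernel Φ w c w' = 0
  | [], _, [], h => absurd rfl h
  | a :: w, c, b :: w', h => wordKernel_of_length_ne w _ w' (by simpa using h)
  | [], _, _ :: _, _ => rfl
  | _ :: _, _, [], _ => rfl

open Classical in
-- Peels one letter off both words uniformly in their shapes. The default letter 0 for an empty word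
-- kills the second summand, so no case distinction on lengths is needed when this is summed over
-- many words.
theorem wordKernel_eq (w : List A) (c : A) (w' : List A) :
    wordKernel Φ w c w' = (if w = [] ∧ w' = [] then c else 0) +
      wordKernel Φ w.tail (Φ (star (w.headD 0) * c * w'.headD 0)) w'.tail := by
  cases w <;> cases w' <;> simp [wordKernel, wordKernel_zero]

end WordKernel

/-! ### Positive definiteness of the word kernel -/

section

variable {H : Type u} [NormedAddCommGroup H] [InnerProductSpace ℂ H] [CompleteSpace H]
  {A : StarSubalgebra ℂ (H →L[ℂ] H)} [IsClosed (A : Set (H →L[ℂ] H))]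

theorem exists_star_mul_self {B : Type*} [NonUnitalCStarAlgebra B] [PartialOrder B]
    [StarOrderedRing B] {b : B} (hb : 0 ≤ b) : ∃ c : B, b = star c * c :=
  CStarAlgebra.nonneg_iff_eq_star_mul_self.mp hb

theorem re_sum_inner_nonneg {ι : Type*} [Fintype ι] (C : CStarMatrix ι ι A) (hC : 0 ≤ C)
    (x : ι → H) : 0 ≤ (∑ i, ∑ j, ⟪(C j i : H →L[ℂ] H) (x i), x j⟫_ℂ).re := by
  obtain ⟨T, rfl⟩ := exists_star_mul_self hC
  have : ∑ i, ∑ j, ⟪((star T * T) j i : H →L[ℂ] H) (x i), x j⟫_ℂ =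
      ∑ k, ⟪∑ i, (T k i : H →L[ℂ] H) (x i), ∑ i, (T k i : H →L[ℂ] H) (x i)⟫_ℂ := by
    simp only [CStarMatrix.mul_apply, CStarMatrix.star_apply, AddSubmonoidClass.coe_finsetSum,
      MulMemClass.coe_mul, StarMemClass.coe_star, _root_.sum_apply,
      sum_inner, inner_sum, ContinuousLinearMap.star_eq_adjoint,
      FunLike.coe_mul_eq_comp, Function.comp_apply, ContinuousLinearMap.adjoint_inner_left]
    rw [Finset.sum_comm]
    conv_rhs => rw [Finset.sum_comm]
    exact Finset.sum_congr rfl fun j _ => Finset.sum_comm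
  rw [this, Complex.re_sum]
  exact Finset.sum_nonneg fun k _ => inner_self_nonneg (𝕜 := ℂ)

/-- Induction on a bound for the word lengths. The statement allows an arbitrary positive matrix `C`
as middle coefficient because one step replaces it by Φ applied entrywise to D* C D, which is
positive by complete positivity. -/
theorem re_sum_inner_wordKernel_nonneg (Φ : A →CP A) {ι : Type*} [Fintype ι] (N : ℕ)
    (w : ι → List A) (hw : ∀ i, (w i).length < N) (C : CStarMatrix ι ι A) (hC : 0 ≤ C) (x : ι → H) :
    0 ≤ (∑ i, ∑ j, ⟪((wordKernel Φ (w j) (C j i) (w i) : A) : H →L[ℂ] H) (x i), x j⟫_ℂ).re := by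
  classical
  induction N generalizing w C x with
  | zero =>
    have : IsEmpty ι := ⟨fun i => absurd (hw i) (Nat.not_lt_zero _)⟩
    simp
  | succ N ih =>
    rcases N with _ | N
    · have hnil : ∀ i, w i = [] := fun i => List.length_eq_zero_iff.mp (by have := hw i; omega)
      simpa only [hnil, wordKernel] using re_sum_inner_nonneg C hC x
    -- Empty words contribute 0 on the diagonal and so drop out of the recursive term `h1`; they are
    -- accounted for by `h2`, in which the vectors of nonempty words are set to zero.
    let D : CStarMatrix ι ι A := CStarMatrix.ofMatrix (Matrix.diagonal fun i => (w i).headD 0)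
    have hD : ∀ i j, (star D * C * D) j i = star ((w j).headD 0) * C j i * (w i).headD 0 := by
      intro i j
      simp [D, CStarMatrix.mul_apply, CStarMatrix.star_apply, Matrix.diagonal, apply_ite star]
    have h1 := ih (fun i => (w i).tail) (fun i => by
      have := hw i; rw [List.length_tail]; omega) ((star D * C * D).map Φ)
      (Φ.map_cstarMatrix_nonneg _ (star_left_conjugate_nonneg hC D)) x
    have h2 := re_sum_inner_nonneg C hC fun i => if w i = [] then x i else 0
    refine (add_nonneg h2 h1).trans_eq ?_
    rw [← Complex.add_re, ← Finset.sum_add_distrib]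
    congr 1
    refine Finset.sum_congr rfl fun i _ => ?_
    rw [← Finset.sum_add_distrib]
    refine Finset.sum_congr rfl fun j _ => ?_
    rw [wordKernel_eq Φ (w j), CStarMatrix.map_apply, hD]
    by_cases hi : w i = [] <;> by_cases hj : w j = [] <;> simp [hi, hj]

end

/-! ### Left multiplication and grading on the space of words -/

section IteratedStinespring

open ContinuousLinearMap

variable {H : Type u} [NormedAddCommGroup H] [InnerProductSpace ℂ H] [CompleteSpace H]
  {A : StarSubalgebra ℂ (H →L[ℂ] H)} [IsClosed (A : Set (H →L[ℂ] H))]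

theorem exists_wordKernel_decomposition (Φ : A →CP A) :
    ∃ (G : Type u) (_ : NormedAddCommGroup G) (_ : InnerProductSpace ℂ G)
      (_ : CompleteSpace G) (γ : List A → H →L[ℂ] G),
      (∀ w w' x y, ⟪γ w x, γ w' y⟫_ℂ = ⟪((wordKernel Φ w' 1 w : A) : H →L[ℂ] H) x, y⟫_ℂ) ∧
      (Submodule.span ℂ {g | ∃ w x, γ w x = g}).topologicalClosure = ⊤ := by
  classical
  refine exists_kolmogorov_decomposition (fun w w' => ((wordKernel Φ w 1 w' : A) : H →L[ℂ] H))
    (fun w w' => ?_) fun f => ?_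
  · rw [← star_eq_adjoint, ← StarMemClass.coe_star, star_wordKernel, star_one]
  · rcases f.support.eq_empty_or_nonempty with h | ⟨w₀, hw₀⟩
    · simp [h]
    -- The all-ones matrix is positive: it equals T* T, where T has one row of ones (at `w₀`) and
    -- zeros elsewhere.
    let C : CStarMatrix f.support f.support A := CStarMatrix.ofMatrix fun _ _ => 1
    let T : CStarMatrix f.support f.support A :=
      CStarMatrix.ofMatrix fun i _ => if i = ⟨w₀, hw₀⟩ then 1 else 0
    have hC : C = star T * T := by
      refine CStarMatrix.ext fun i j => ?_
      have hT : ∀ k, (star T) i k * T k j = if k = ⟨w₀, hw₀⟩ then 1 else 0 := fun k => by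
        change star (if k = ⟨w₀, hw₀⟩ then (1 : A) else 0) * (if k = ⟨w₀, hw₀⟩ then 1 else 0) = _
        split_ifs <;> simp
      rw [CStarMatrix.mul_apply]
      simp only [hT, Finset.sum_ite_eq', Finset.mem_univ, if_true]
      rfl
    have h := re_sum_inner_wordKernel_nonneg Φ (f.support.sup List.length + 1)
      (fun i : f.support => i.1)
      (fun i => Nat.lt_succ_of_le (Finset.le_sup (f := List.length) i.2)) C
      (hC ▸ star_mul_self_nonneg T) fun i => f i
    refine h.trans_eq (congrArg Complex.re ?_)
    rw [← Finset.sum_coe_sort f.support]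
    refine Finset.sum_congr rfl fun i _ => ?_
    rw [← Finset.sum_coe_sort f.support]
    rfl

/-- The defect ‖a‖²·1 − a* a is positive, hence of the form e* e. This is what bounds left
multiplication by `a`. -/
theorem exists_star_mul_self_add (a : A) :
    ∃ e : A, star a * a + star e * e = ((‖a‖ ^ 2 : ℝ) : ℂ) • (1 : A) := by
  have h : 0 ≤ ((‖a‖ ^ 2 : ℝ) : ℂ) • (1 : A) - star a * a := by
    have := CStarAlgebra.star_mul_le_algebraMap_norm_sq (a := a)
    rw [sub_nonneg]
    refine this.trans_eq ?_
    rw [Algebra.algebraMap_eq_smul_one]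
    rfl
  obtain ⟨e, he⟩ := exists_star_mul_self h
  exact ⟨e, by rw [← he]; abel⟩

variable {G : Type*} [NormedAddCommGroup G] [InnerProductSpace ℂ G]

/-- Left multiplication on the vectors `γ w x` indexed by words. -/
noncomputable def wordAct (γ : List A → H →L[ℂ] G) (a : A) : List A → H →L[ℂ] G
  | [] => γ [] ∘L (a : H →L[ℂ] H)
  | b :: w => γ ((a * b) :: w)

variable {Φ : A →CP A} {γ : List A → H →L[ℂ] G}
  (hγ : ∀ w w' x y, ⟪γ w x, γ w' y⟫_ℂ = ⟪((wordKernel Φ w' 1 w : A) : H →L[ℂ] H) x, y⟫_ℂ)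
  (htot : (Submodule.span ℂ {g | ∃ w x, γ w x = g}).topologicalClosure = ⊤)

omit [IsClosed (A : Set (H →L[ℂ] H))] in
theorem wordAct_one (γ : List A → H →L[ℂ] G) : wordAct γ 1 = γ := by
  funext w
  cases w
  · ext x
    simp [wordAct]
  · simp [wordAct]

include hγ in
theorem inner_wordAct (a a' : A) (w w' : List A) (x y : H) :
    ⟪wordAct γ a w x, wordAct γ a' w' y⟫_ℂ =
      ⟪((wordKernel Φ w' (star a' * a) w : A) : H →L[ℂ] H) x, y⟫_ℂ := by
  cases w <;> cases w' <;>
    simp [wordAct, hγ, wordKernel, star_eq_adjoint, adjoint_inner_left, mul_assoc]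

include hγ in
-- The kernel is linear in its middle argument, so with a* a + e* e = ‖a‖²·1 the squared norms of
-- the vectors moved by `a` and by `e` add up to ‖a‖² times the original squared norm.
theorem norm_sumMap_wordAct_le (a : A) (f : List A →₀ H) :
    ‖sumMap (wordAct γ a) f‖ ≤ ‖a‖ * ‖sumMap γ f‖ := by
  obtain ⟨e, he⟩ := exists_star_mul_self_add a
  have h : ∀ b : A, ⟪sumMap (wordAct γ b) f, sumMap (wordAct γ b) f⟫_ℂ =
      ∑ w ∈ f.support, ∑ w' ∈ f.support,
        ⟪((wordKernel Φ w' (star b * b) w : A) : H →L[ℂ] H) (f w), f w'⟫_ℂ := fun b => by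
    rw [inner_sumMap]
    simp only [inner_wordAct hγ]
  have key : ⟪sumMap (wordAct γ a) f, sumMap (wordAct γ a) f⟫_ℂ +
      ⟪sumMap (wordAct γ e) f, sumMap (wordAct γ e) f⟫_ℂ =
      ((‖a‖ ^ 2 : ℝ) : ℂ) * ⟪sumMap γ f, sumMap γ f⟫_ℂ := by
    conv_rhs => rw [← wordAct_one γ]
    rw [h, h, h, Finset.mul_sum, ← Finset.sum_add_distrib]
    refine Finset.sum_congr rfl fun w _ => ?_
    rw [Finset.mul_sum, ← Finset.sum_add_distrib]
    refine Finset.sum_congr rfl fun w' _ => ?_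
    rw [← inner_add_left, ← add_apply, ← AddMemClass.coe_add, ← wordKernel_add, he,
      wordKernel_smul, star_one, one_mul]
    simp [inner_smul_left]
  have hre : ∀ g : G, (⟪g, g⟫_ℂ).re = ‖g‖ ^ 2 := inner_self_eq_norm_sq (𝕜 := ℂ)
  have key' := congrArg Complex.re key
  rw [Complex.add_re, Complex.re_ofReal_mul, hre, hre, hre] at key'
  refine le_of_sq_le_sq ?_ (by positivity)
  nlinarith [sq_nonneg ‖sumMap (wordAct γ e) f‖]

omit [IsClosed (A : Set (H →L[ℂ] H))] in
include htot in
theorem eq_of_inner_eq_of_total [CompleteSpace G] {S T : G →L[ℂ] G}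
    (h : ∀ w w' x y, ⟪S (γ w x), γ w' y⟫_ℂ = ⟪T (γ w x), γ w' y⟫_ℂ) : S = T := by
  refine ext_of_total htot fun w x => ?_
  refine (denseRange_sumMap htot).eq_of_inner_left ℂ fun f => ?_
  simp [sumMap_apply, inner_sum, h]

include hγ htot in
theorem exists_wordRep [CompleteSpace G] :
    ∃ π : A →⋆ₐ[ℂ] (G →L[ℂ] G), ∀ a w x, π a (γ w x) = wordAct γ a w x := by
  choose T hT using fun a : A => exists_extension htot (wordAct γ a) ‖a‖
    (norm_sumMap_wordAct_le hγ a)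
  have hin : ∀ a w w' x y, ⟪T a (γ w x), γ w' y⟫_ℂ =
      ⟪((wordKernel Φ w' a w : A) : H →L[ℂ] H) x, y⟫_ℂ := fun a w w' x y => by
    have := inner_wordAct hγ a 1 w w' x y
    rwa [wordAct_one, star_one, one_mul, ← hT] at this
  have hsmul : ∀ (r : ℂ) (a : A), T (r • a) = r • T a := fun r a =>
    eq_of_inner_eq_of_total htot fun w w' x y => by
      simp [hin, wordKernel_smul]
  have hone : T 1 = 1 := ext_of_total htot fun w x => by rw [hT, wordAct_one]; rfl
  refine ⟨{ toFun := T, map_one' := hone, map_mul' := fun a b => ?_, map_zero' := ?_,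
            map_add' := fun a b => ?_, commutes' := fun r => ?_, map_star' := fun a => ?_ }, hT⟩
  · refine ext_of_total htot fun w x => ?_
    rw [hT, mul_apply_eq_comp, hT]
    cases w <;> simp [wordAct, hT, mul_assoc]
  · simpa using hsmul 0 0
  · refine eq_of_inner_eq_of_total htot fun w w' x y => ?_
    simp [hin, wordKernel_add]
  · rw [Algebra.algebraMap_eq_smul_one, hsmul, hone, Algebra.algebraMap_eq_smul_one]
  · refine eq_of_inner_eq_of_total htot fun w w' x y => ?_
    rw [hin, star_eq_adjoint, adjoint_inner_left, ← inner_conj_symm (γ w x), hin, inner_conj_symm,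
      ← star_wordKernel Φ w a w', StarMemClass.coe_star, star_eq_adjoint, adjoint_inner_left]

/-- The closed span of the vectors indexed by the words of length `n`. -/
noncomputable def wordSpace (γ : List A → H →L[ℂ] G) (n : ℕ) : Submodule ℂ G :=
  (Submodule.span ℂ {g | ∃ w x, w.length = n ∧ γ w x = g}).topologicalClosure

omit [IsClosed (A : Set (H →L[ℂ] H))] in
theorem mem_wordSpace (γ : List A → H →L[ℂ] G) (w : List A) (x : H) :
    γ w x ∈ wordSpace γ w.length :=
  Submodule.le_topologicalClosure _ (Submodule.subset_span ⟨w, x, rfl, rfl⟩)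

omit [IsClosed (A : Set (H →L[ℂ] H))] in
theorem wordSpace_le {γ : List A → H →L[ℂ] G} {n : ℕ} {F : Submodule ℂ G}
    (hF : IsClosed (F : Set G)) (h : ∀ w x, w.length = n → γ w x ∈ F) : wordSpace γ n ≤ F := by
  refine Submodule.topologicalClosure_minimal _ (Submodule.span_le.mpr ?_) hF
  rintro _ ⟨w, x, hw, rfl⟩
  exact h w x hw

omit [IsClosed (A : Set (H →L[ℂ] H))] in
theorem isClosed_wordSpace (γ : List A → H →L[ℂ] G) (n : ℕ) :
    IsClosed (wordSpace γ n : Set G) := Submodule.isClosed_topologicalClosure _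

include hγ in
-- The kernel vanishes on words of different lengths.
theorem wordSpace_le_orthogonal {m n : ℕ} (hmn : m ≠ n) : wordSpace γ m ≤ (wordSpace γ n)ᗮ := by
  refine wordSpace_le (Submodule.isClosed_orthogonal _) fun w x hw => ?_
  rw [Submodule.mem_orthogonal']
  refine fun g hg => LinearMap.mem_ker.mp
    (wordSpace_le (F := (innerSL ℂ (γ w x)).ker) (isClosed_ker _) (fun w' y hw' => ?_) hg)
  rw [LinearMap.mem_ker]
  change ⟪γ w x, γ w' y⟫_ℂ = 0
  rw [hγ, wordKernel_of_length_ne _ _ _ _ (by omega)]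
  simp

include hγ htot in
theorem isHilbertSum_wordSpace [CompleteSpace G] :
    IsHilbertSum ℂ (fun n => wordSpace γ n) (fun n => (wordSpace γ n).subtypeₗᵢ) := by
  have hc : ∀ n, CompleteSpace (wordSpace γ n) := fun n =>
    (isClosed_wordSpace γ n).completeSpace_coe
  refine IsHilbertSum.mkInternal _ (fun m n hmn x y => ?_) ?_
  · exact Submodule.inner_left_of_mem_orthogonal y.2 (wordSpace_le_orthogonal hγ hmn x.2)
  · rw [← htot]
    refine Submodule.topologicalClosure_mono (Submodule.span_le.mpr ?_)
    rintro _ ⟨w, x, rfl⟩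
    exact Submodule.mem_iSup_of_mem w.length (mem_wordSpace γ w x)

end IteratedStinespring

/-! ### Existence of the iterated Stinespring representation -/

section

variable {H : Type u} [NormedAddCommGroup H] [InnerProductSpace ℂ H] [CompleteSpace H]
  {A : StarSubalgebra ℂ (H →L[ℂ] H)} [IsClosed (A : Set (H →L[ℂ] H))]

open ContinuousLinearMap

theorem inner_compress {H K : Type*} [NormedAddCommGroup H] [InnerProductSpace ℂ H]
    [CompleteSpace H] [NormedAddCommGroup K] [InnerProductSpace ℂ K] [CompleteSpace K]
    (Z : H →ₗᵢ[ℂ] K) (X : K →L[ℂ] K) (x y : H) :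
    ⟪compress Z X x, y⟫_ℂ = ⟪X (Z x), Z y⟫_ℂ := by
  simp [compress, adjoint_inner_left]

/-- Every unital completely positive map has an iterated Stinespring representation. -/
theorem exists_isStinespringRepresentation (Φ : A →CP A) (hΦ : Φ 1 = 1) :
    ∃ (K : Type u) (_ : NormedAddCommGroup K) (_ : InnerProductSpace ℂ K) (_ : CompleteSpace K)
      (π : A →⋆ₐ[ℂ] (K →L[ℂ] K)) (V : K →ₗᵢ[ℂ] K) (E : ℕ → Submodule ℂ K) (j : H →ₗᵢ[ℂ] K),
      IsStinespringRepresentation A Φ π V E j := by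
  obtain ⟨G, _, _, _, γ, hγ, htot⟩ := exists_wordKernel_decomposition Φ
  obtain ⟨π, hπ⟩ := exists_wordRep hγ htot
  -- V prepends the letter 1; it preserves inner products because Φ(1) = 1.
  obtain ⟨V, hV⟩ := exists_linearIsometry htot (fun w => γ (1 :: w)) fun w w' x y => by
    rw [hγ, hγ]
    simp [wordKernel, hΦ]
  have hj : ∀ x, ‖γ [] x‖ = ‖x‖ := fun x => by
    rw [← sq_eq_sq₀ (norm_nonneg _) (norm_nonneg _), ← inner_self_eq_norm_sq (𝕜 := ℂ),
      ← inner_self_eq_norm_sq (𝕜 := ℂ), hγ]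
    rfl
  have hin : ∀ a w w' x y, ⟪π a (γ w x), γ w' y⟫_ℂ =
      ⟪((wordKernel Φ w' a w : A) : H →L[ℂ] H) x, y⟫_ℂ := fun a w w' x y => by
    have := inner_wordAct hγ a 1 w w' x y
    rwa [wordAct_one, star_one, one_mul, ← hπ] at this
  let j : H →ₗᵢ[ℂ] G := ⟨(γ []).toLinearMap, hj⟩
  have hred : ∀ (n : ℕ) (a : A), ∀ x ∈ wordSpace γ n, π a x ∈ wordSpace γ n := fun n a x hx => by
    refine wordSpace_le (F := (wordSpace γ n).comap (π a).toLinearMap)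
      ((isClosed_wordSpace γ n).preimage (π a).continuous) (fun w x hw => ?_) hx
    subst hw
    change π a (γ w x) ∈ wordSpace γ w.length
    rw [hπ]
    cases w with
    | nil => exact mem_wordSpace γ [] _
    | cons b w => exact mem_wordSpace γ ((a * b) :: w) x
  have hshift : ∀ n : ℕ, ∀ x ∈ wordSpace γ n, V x ∈ wordSpace γ (n + 1) := fun n x hx => by
    refine wordSpace_le (F := (wordSpace γ (n + 1)).comap V.toLinearMap)
      ((isClosed_wordSpace γ (n + 1)).preimage V.continuous) (fun w x hw => ?_) hx
    subst hw
    change V (γ w x) ∈ wordSpace γ (w.length + 1)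
    rw [hV]
    exact mem_wordSpace γ (1 :: w) x
  refine ⟨G, inferInstance, inferInstance, inferInstance, π, V, wordSpace γ, j, ?_, ?_, hred, ?_,
    ?_, hshift, ?_⟩
  · refine fun a => eq_of_inner_eq_of_total htot fun w w' x y => ?_
    rw [inner_compress, hV, hV, hin, hin]
    simp [wordKernel]
  · exact isHilbertSum_wordSpace hγ htot
  · refine le_antisymm ?_ (wordSpace_le ?_ fun w x hw => ?_)
    · rintro _ ⟨x, rfl⟩
      exact mem_wordSpace γ [] x
    · exact j.isometry.isClosedEmbedding.isClosed_range
    · rw [List.length_eq_zero_iff.mp hw]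
      exact ⟨x, rfl⟩
  · exact fun a x => hπ a [] x
  · refine fun n => le_antisymm ?_ (wordSpace_le (Submodule.isClosed_topologicalClosure _) ?_)
    · refine Submodule.topologicalClosure_minimal _ (Submodule.span_le.mpr ?_)
        (isClosed_wordSpace γ _)
      rintro _ ⟨a, x, hx, rfl⟩
      exact hred _ a _ (hshift n x hx)
    · rintro (_ | ⟨a, w⟩) x hw
      · simp at hw
      · refine Submodule.le_topologicalClosure _ (Submodule.subset_span ⟨a, γ w x, ?_, ?_⟩)
        · obtain rfl : w.length = n := by simpa using hw
          exact mem_wordSpace γ w x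
        · rw [hV, hπ]
          simp [wordAct]

end

/-! ### Minimal unitary dilation of an isometry -/

section UnitaryDilation

open ContinuousLinearMap

variable {K : Type u} [NormedAddCommGroup K] [InnerProductSpace ℂ K] [CompleteSpace K]

/-- The Toeplitz kernel of an operator `W`. -/
noncomputable def toeplitz (W : K →L[ℂ] K) (m n : ℤ) : K →L[ℂ] K :=
  star (W ^ (m - min m n).toNat) * W ^ (n - min m n).toNat

variable {W : K →L[ℂ] K}

theorem star_pow_mul_pow_of_isometry (hW : star W * W = 1) (n : ℕ) :
    star (W ^ n) * W ^ n = 1 := by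
  induction n with
  | zero => simp
  | succ n ih => rw [pow_succ, star_mul, mul_assoc, ← mul_assoc (star (W ^ n)), ih, one_mul, hW]

/-- Any common lower bound may replace the minimum, since the surplus powers cancel through W* W =
1. -/
theorem toeplitz_eq (hW : star W * W = 1) {m n N : ℤ} (hm : N ≤ m) (hn : N ≤ n) :
    toeplitz W m n = star (W ^ (m - N).toNat) * W ^ (n - N).toNat := by
  have h1 : (m - N).toNat = (min m n - N).toNat + (m - min m n).toNat := by omega
  have h2 : (n - N).toNat = (min m n - N).toNat + (n - min m n).toNat := by omega
  rw [h1, h2, pow_add, pow_add, star_mul, mul_assoc, ← mul_assoc (star (W ^ (min m n - N).toNat)),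
    star_pow_mul_pow_of_isometry hW, one_mul, toeplitz]

theorem exists_toeplitz_decomposition (hW : star W * W = 1) :
    ∃ (G : Type u) (_ : NormedAddCommGroup G) (_ : InnerProductSpace ℂ G)
      (_ : CompleteSpace G) (γ : ℤ → K →L[ℂ] G),
      (∀ m n x y, ⟪γ m x, γ n y⟫_ℂ = ⟪toeplitz W n m x, y⟫_ℂ) ∧
      (Submodule.span ℂ {g | ∃ n x, γ n x = g}).topologicalClosure = ⊤ := by
  refine exists_kolmogorov_decomposition (toeplitz W) (fun m n => ?_) fun f => ?_
  · rw [← star_eq_adjoint, toeplitz, star_mul, star_star, min_comm]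
    rfl
  -- Shifting all indices by one lower bound `N` of the support turns the quadratic form into a
  -- squared norm.
  · obtain ⟨N, hN⟩ := f.support.bddBelow
    have : ∑ m ∈ f.support, ∑ n ∈ f.support, ⟪toeplitz W n m (f m), f n⟫_ℂ =
        ⟪∑ m ∈ f.support, (W ^ (m - N).toNat) (f m), ∑ m ∈ f.support, (W ^ (m - N).toNat) (f m)⟫_ℂ := by
      simp only [sum_inner, inner_sum]
      rw [Finset.sum_comm]
      refine Finset.sum_congr rfl fun n hn => Finset.sum_congr rfl fun m hm => ?_
      rw [toeplitz_eq hW (hN hn) (hN hm), star_eq_adjoint, mul_apply_eq_comp, adjoint_inner_left]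
    rw [this]
    exact inner_self_nonneg (𝕜 := ℂ)

theorem star_toContinuousLinearMap_mul_self (V : K →ₗᵢ[ℂ] K) :
    star V.toContinuousLinearMap * V.toContinuousLinearMap = 1 := by
  ext x
  refine ext_inner_right ℂ fun y => ?_
  rw [star_eq_adjoint, mul_apply_eq_comp, adjoint_inner_left]
  exact V.inner_map_map x y

/-- Every isometry has a minimal unitary dilation. -/
theorem exists_isMinimalUnitaryDilation (V : K →ₗᵢ[ℂ] K) :
    ∃ (K' : Type u) (_ : NormedAddCommGroup K') (_ : InnerProductSpace ℂ K')
      (_ : CompleteSpace K') (U : unitary (K' →L[ℂ] K')) (Z : K →ₗᵢ[ℂ] K'),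
      IsMinimalUnitaryDilation V U Z := by
  have hW := star_toContinuousLinearMap_mul_self V
  obtain ⟨G, _, _, _, γ, hγ, htot⟩ := exists_toeplitz_decomposition hW
  obtain ⟨S, hS⟩ := exists_linearIsometry htot (fun n => γ (n + 1)) fun m n x y => by
    rw [hγ, hγ, toeplitz, toeplitz, min_add_add_right, add_sub_add_right_eq_sub,
      add_sub_add_right_eq_sub]
  obtain ⟨T, hT⟩ := exists_linearIsometry htot (fun n => γ (n - 1)) fun m n x y => by
    rw [hγ, hγ, toeplitz, toeplitz, min_sub_sub_right, sub_sub_sub_cancel_right,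
      sub_sub_sub_cancel_right]
  have hST : S.toContinuousLinearMap * T.toContinuousLinearMap = 1 :=
    ext_of_total htot fun n x => by simp [hS, hT]
  have hSS := star_toContinuousLinearMap_mul_self S
  have hstar : star S.toContinuousLinearMap = T.toContinuousLinearMap := by
    rw [← mul_one (star S.toContinuousLinearMap), ← hST, ← mul_assoc, hSS, one_mul]
  let U : unitary (G →L[ℂ] G) := ⟨S.toContinuousLinearMap, hSS, by rw [hstar, hST]⟩
  have hU : ∀ m x, (U : G →L[ℂ] G) (γ m x) = γ (m + 1) x := hS
  have hU' : ∀ m x, ((U⁻¹ : unitary (G →L[ℂ] G)) : G →L[ℂ] G) (γ m x) = γ (m - 1) x :=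
    fun m x => by
      rw [← Unitary.star_eq_inv, Unitary.coe_star]
      change (star S.toContinuousLinearMap) (γ m x) = _
      rw [hstar]
      exact hT m x
  have hUz : ∀ (k : ℤ) m x, ((U ^ k : unitary (G →L[ℂ] G)) : G →L[ℂ] G) (γ m x) = γ (m + k) x := by
    intro k
    induction k using Int.induction_on with
    | zero => simp
    | succ k ih =>
      intro m x
      rw [zpow_add_one, Submonoid.coe_mul, mul_apply_eq_comp, hU, ih]
      congr 2
      ring
    | pred k ih =>
      intro m x
      rw [zpow_sub_one, Submonoid.coe_mul, mul_apply_eq_comp, hU', ih]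
      congr 2
      ring
  have hnorm : ∀ x, ‖γ 0 x‖ = ‖x‖ := fun x => by
    rw [← sq_eq_sq₀ (norm_nonneg _) (norm_nonneg _), ← inner_self_eq_norm_sq (𝕜 := ℂ),
      ← inner_self_eq_norm_sq (𝕜 := ℂ), hγ]
    simp [toeplitz]
  -- Both sides have the same inner products with the total family `γ p`, as one sees by computing
  -- both kernels from the base point min p n.
  have hV : ∀ n x, γ n (V x) = γ (n + 1) x := fun n x => by
    refine (denseRange_sumMap htot).eq_of_inner_left ℂ fun f => ?_
    simp only [sumMap_apply, inner_sum, hγ]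
    refine Finset.sum_congr rfl fun p _ => ?_
    rw [toeplitz_eq hW (min_le_left p n) (min_le_right p n),
      toeplitz_eq hW (min_le_left p n) ((min_le_right p n).trans (by omega)),
      show (n + 1 - min p n).toNat = (n - min p n).toNat + 1 by omega, pow_succ]
    rfl
  have hVn : ∀ (k : ℕ) n x, γ n (V^[k] x) = γ (n + k) x := by
    intro k
    induction k with
    | zero => simp
    | succ k ih =>
      intro n x
      rw [Function.iterate_succ_apply, ih, hV]
      congr 2
      push_cast
      ring
  refine ⟨G, inferInstance, inferInstance, inferInstance, U, ⟨(γ 0).toLinearMap, hnorm⟩, ?_, ?_⟩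
  · intro n x
    change ((U : G →L[ℂ] G) ^ n) (γ 0 x) = γ 0 (V^[n] x)
    rw [hVn, ← hUz]
    simp
  · rw [← htot]
    congr 2
    ext g
    refine exists_congr fun k => exists_congr fun x => ?_
    rw [eq_comm]
    rw [show γ k x = _ by rw [← zero_add k, ← hUz]]
    rfl

end UnitaryDilation

/-! ### The dilated algebra and its compression -/

section MultiplicativeDilation

open ContinuousLinearMap

variable {H K L : Type*} [NormedAddCommGroup H] [InnerProductSpace ℂ H] [CompleteSpace H]
  [NormedAddCommGroup K] [InnerProductSpace ℂ K] [CompleteSpace K]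
  [NormedAddCommGroup L] [InnerProductSpace ℂ L] [CompleteSpace L]
  {A : StarSubalgebra ℂ (H →L[ℂ] H)}

/-- The operators `π(a₀) V π(a₁) V ⋯ V π(aₙ)`. -/
inductive IsWord (π : A →⋆ₐ[ℂ] (K →L[ℂ] K)) (V : K →ₗᵢ[ℂ] K) : ℕ → (K →L[ℂ] K) → Prop
  | zero (a : A) : IsWord π V 0 (π a)
  | succ {n : ℕ} (a : A) {w : K →L[ℂ] K} (hw : IsWord π V n w) :
      IsWord π V (n + 1) (π a * (V.toContinuousLinearMap * w))

variable {Φ : A → A} {π : A →⋆ₐ[ℂ] (K →L[ℂ] K)} {V : K →ₗᵢ[ℂ] K}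

theorem compress_eq (V : K →ₗᵢ[ℂ] K) (X : K →L[ℂ] K) :
    compress V X = star V.toContinuousLinearMap * (X * V.toContinuousLinearMap) := rfl

theorem IsWord.rep_mul {n : ℕ} {w : K →L[ℂ] K} (hw : IsWord π V n w) (a : A) :
    IsWord π V n (π a * w) := by
  cases hw with
  | zero b => rw [← map_mul]; exact .zero _
  | succ b hw => rw [← mul_assoc, ← map_mul]; exact .succ _ hw

theorem IsWord.isometry_mul {n : ℕ} {w : K →L[ℂ] K} (hw : IsWord π V n w) :
    IsWord π V (n + 1) (V.toContinuousLinearMap * w) := by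
  simpa using IsWord.succ 1 hw

theorem IsWord.isometry_pow_mul {n : ℕ} {w : K →L[ℂ] K} (hw : IsWord π V n w) (k : ℕ) :
    IsWord π V (n + k) (V.toContinuousLinearMap ^ k * w) := by
  induction k with
  | zero => simpa using hw
  | succ k ih => rw [pow_succ', mul_assoc]; exact ih.isometry_mul

/-- Covariance absorbs the leading V: V* π(b) V w = π(Φ(b)) w, and the new coefficient merges with
the first letter of w. -/
theorem IsWord.star_isometry_mul (hcov : ∀ a : A, compress V (π a) = π (Φ a)) {n : ℕ}
    {w : K →L[ℂ] K} (hw : IsWord π V (n + 1) w) :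
    IsWord π V n (star V.toContinuousLinearMap * w) := by
  cases hw with
  | succ b hw =>
    rw [← mul_assoc, ← mul_assoc, mul_assoc (star _), ← compress_eq, hcov]
    exact hw.rep_mul _

theorem IsWord.star_isometry_pow_mul (hcov : ∀ a : A, compress V (π a) = π (Φ a)) (n k : ℕ)
    {w : K →L[ℂ] K} (hw : IsWord π V (n + k) w) :
    IsWord π V n (star (V.toContinuousLinearMap ^ k) * w) := by
  induction k generalizing w with
  | zero => simpa using hw
  | succ k ih =>
    rw [pow_succ', star_mul, mul_assoc]
    exact ih (hw.star_isometry_mul hcov)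

/-- The embedding `U⁻ⁿ Z`. -/
noncomputable def backShift (U : unitary (L →L[ℂ] L)) (Z : K →ₗᵢ[ℂ] L) (n : ℕ) : K →L[ℂ] L :=
  (star (U : L →L[ℂ] L) ^ n) ∘L Z.toContinuousLinearMap

/-- The operators `U⁻ⁿ Z π(a) Z* Uⁿ`. -/
def dilationGenerators (π : A →⋆ₐ[ℂ] (K →L[ℂ] K)) (U : unitary (L →L[ℂ] L)) (Z : K →ₗᵢ[ℂ] L) :
    Set (L →L[ℂ] L) :=
  {X | ∃ (n : ℕ) (a : A), X = backShift U Z n ∘L π a ∘L adjoint (backShift U Z n)}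

variable {U : unitary (L →L[ℂ] L)} {Z : K →ₗᵢ[ℂ] L}

omit [CompleteSpace K] in
theorem backShift_zero : backShift U Z 0 = Z.toContinuousLinearMap := rfl

theorem adjoint_backShift_comp_self (n : ℕ) :
    adjoint (backShift U Z n) ∘L backShift U Z n = 1 := by
  have h : star ((star (U : L →L[ℂ] L)) ^ n) * star (U : L →L[ℂ] L) ^ n = 1 :=
    star_pow_mul_pow_of_isometry (by simp) n
  ext x
  refine ext_inner_right ℂ fun y => ?_
  rw [comp_apply, adjoint_inner_left, backShift, comp_apply, comp_apply, ← adjoint_inner_left,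
    ← star_eq_adjoint, ← mul_apply_eq_comp, h]
  exact Z.inner_map_map x y

omit [CompleteSpace K] in
theorem star_unitary_comp_backShift (n : ℕ) :
    star (U : L →L[ℂ] L) ∘L backShift U Z n = backShift U Z (n + 1) := by
  rw [backShift, ← comp_assoc, ← mul_def, ← pow_succ']
  rfl

omit [CompleteSpace K] in
theorem backShift_succ_comp (hdil : IsMinimalUnitaryDilation V U Z) (n : ℕ) :
    backShift U Z (n + 1) ∘L V.toContinuousLinearMap = backShift U Z n := by
  ext x
  have h := hdil.intertwines 1 x
  simp only [pow_one, Function.iterate_one] at h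
  simp only [backShift, comp_apply, pow_succ, mul_apply_eq_comp,
    LinearIsometry.coe_toContinuousLinearMap]
  rw [← h, ← mul_apply_eq_comp (star _), Unitary.coe_star_mul_self]
  rfl

omit [CompleteSpace K] in
theorem backShift_add_comp (hdil : IsMinimalUnitaryDilation V U Z) (n k : ℕ) :
    backShift U Z (n + k) ∘L (V.toContinuousLinearMap ^ k) = backShift U Z n := by
  induction k with
  | zero => rfl
  | succ k ih =>
    rw [pow_succ', ← add_assoc, mul_def, ← comp_assoc, backShift_succ_comp hdil, ih]

/-- The operator Z* Uᵐ U⁻ⁿ Z equals Vᵐ⁻ⁿ when m ≥ n and (V*)ⁿ⁻ᵐ when n ≥ m. In either case it turns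
a word with n factors V into one with m. -/
theorem adjoint_backShift_comp_word (hcov : ∀ a : A, compress V (π a) = π (Φ a))
    (hdil : IsMinimalUnitaryDilation V U Z) (m : ℕ) {n : ℕ} {w : K →L[ℂ] K}
    (hw : IsWord π V n w) : IsWord π V m (adjoint (backShift U Z m) ∘L (backShift U Z n ∘L w)) := by
  rcases le_total n m with h | h
  · obtain ⟨k, rfl⟩ := Nat.exists_eq_add_of_le h
    rw [← backShift_add_comp hdil n k, ← comp_assoc, ← comp_assoc, adjoint_backShift_comp_self]
    exact hw.isometry_pow_mul k
  · obtain ⟨k, rfl⟩ := Nat.exists_eq_add_of_le h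
    rw [← backShift_add_comp hdil m k, adjoint_comp, ← comp_assoc,
      comp_assoc (adjoint _) (adjoint _), adjoint_backShift_comp_self]
    exact hw.star_isometry_pow_mul hcov m k

/-- A generator at level m sends U⁻ⁿ Z w to U⁻ᵐ Z times a word with m factors V. The generating set
is self-adjoint, so invariance extends to the whole *-algebra by plain algebra induction. -/
theorem comp_mem_span_words (hcov : ∀ a : A, compress V (π a) = π (Φ a))
    (hdil : IsMinimalUnitaryDilation V U Z) {X : L →L[ℂ] L}
    (hX : X ∈ StarAlgebra.adjoin ℂ (dilationGenerators π U Z)) :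
    ∀ Y ∈ Submodule.span ℂ {Y : K →L[ℂ] L | ∃ n w, IsWord π V n w ∧ Y = backShift U Z n ∘L w},
      X ∘L Y ∈ Submodule.span ℂ {Y : K →L[ℂ] L | ∃ n w, IsWord π V n w ∧
        Y = backShift U Z n ∘L w} := by
  have hstar : star (dilationGenerators π U Z) ⊆ dilationGenerators π U Z := by
    rintro X ⟨n, a, h⟩
    refine ⟨n, star a, ?_⟩
    rw [← star_star X, h, star_eq_adjoint, adjoint_comp, adjoint_comp, adjoint_adjoint, map_star,
      star_eq_adjoint, comp_assoc]
  rw [← StarSubalgebra.mem_toSubalgebra, StarAlgebra.adjoin_toSubalgebra,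
    Set.union_eq_self_of_subset_right hstar] at hX
  induction hX using Algebra.adjoin_induction with
  | mem X hX =>
    obtain ⟨m, a, rfl⟩ := hX
    intro Y hY
    induction hY using Submodule.span_induction with
    | mem Y hY =>
      obtain ⟨n, w, hw, rfl⟩ := hY
      refine Submodule.subset_span
        ⟨m, _, (adjoint_backShift_comp_word hcov hdil m hw).rep_mul a, ?_⟩
      simp only [mul_def, comp_assoc]
    | zero => simp
    | add Y Y' _ _ h h' => rw [comp_add]; exact add_mem h h'
    | smul r Y _ h => rw [comp_smul]; exact Submodule.smul_mem _ r h
  | algebraMap r =>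
    intro Y hY
    rw [Algebra.algebraMap_eq_smul_one, smul_comp]
    exact Submodule.smul_mem _ r hY
  | add X X' _ _ h h' =>
    intro Y hY
    rw [add_comp]
    exact add_mem (h Y hY) (h' Y hY)
  | mul X X' _ _ h h' =>
    intro Y hY
    rw [mul_def, comp_assoc]
    exact h _ (h' Y hY)

/-- Compression to `K` maps the *-algebra generated by the operators `U⁻ⁿ Z π(a) Z* Uⁿ` into
the range of `π`. -/
theorem compress_mem_range (hcov : ∀ a : A, compress V (π a) = π (Φ a))
    (hdil : IsMinimalUnitaryDilation V U Z) {X : L →L[ℂ] L}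
    (hX : X ∈ StarAlgebra.adjoin ℂ (dilationGenerators π U Z)) : compress Z X ∈ π.range := by
  -- Z itself is U⁰ Z π(1), hence lies in the invariant span.
  have h := comp_mem_span_words hcov hdil hX Z.toContinuousLinearMap
    (Submodule.subset_span ⟨0, π 1, .zero 1, by rw [map_one]; rfl⟩)
  suffices ∀ Y ∈ Submodule.span ℂ
      {Y : K →L[ℂ] L | ∃ n w, IsWord π V n w ∧ Y = backShift U Z n ∘L w},
      adjoint Z.toContinuousLinearMap ∘L Y ∈ π.range from this _ h
  intro Y hY
  induction hY using Submodule.span_induction with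
  | mem Y hY =>
    obtain ⟨n, w, hw, rfl⟩ := hY
    have hw' := adjoint_backShift_comp_word hcov hdil 0 hw
    rw [backShift_zero] at hw'
    generalize adjoint Z.toContinuousLinearMap ∘L backShift U Z n ∘L w = w' at hw'
    cases hw' with
    | zero a => exact ⟨a, rfl⟩
  | zero => simp
  | add Y Y' _ _ h h' => rw [comp_add]; exact add_mem h h'
  | smul r Y _ h => rw [comp_smul]; exact SMulMemClass.smul_mem r h

theorem inflate_mem_dilationGenerators (a : A) : inflate Z (π a) ∈ dilationGenerators π U Z :=
  ⟨0, a, rfl⟩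

theorem star_mul_generator_mul_mem {X : L →L[ℂ] L} (hX : X ∈ dilationGenerators π U Z) :
    star (U : L →L[ℂ] L) * X * U ∈ dilationGenerators π U Z := by
  obtain ⟨n, a, rfl⟩ := hX
  refine ⟨n + 1, a, ?_⟩
  rw [← star_unitary_comp_backShift, adjoint_comp, ← star_eq_adjoint (star _), star_star]
  simp only [mul_def, comp_assoc]

theorem compress_inflate (Z : K →ₗᵢ[ℂ] L) (T : K →L[ℂ] K) : compress Z (inflate Z T) = T := by
  ext x
  refine ext_inner_right ℂ fun y => ?_
  rw [inner_compress]
  have h : adjoint Z.toContinuousLinearMap (Z x) = x :=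
    congrArg (fun T : K →L[ℂ] K => T x) (adjoint_backShift_comp_self (U := 1) (Z := Z) 0)
  simp [inflate, h]

/-- Immediate from U Z = Z V. Together with covariance it says that compression carries conjugation
by U to Φ. -/
theorem compress_conj (hdil : IsMinimalUnitaryDilation V U Z) (X : L →L[ℂ] L) :
    compress Z (star (U : L →L[ℂ] L) * X * U) = compress V (compress Z X) := by
  ext x
  refine ext_inner_right ℂ fun y => ?_
  have h : ∀ x, (U : L →L[ℂ] L) (Z x) = Z (V x) := fun x => by
    simpa using hdil.intertwines 1 x
  rw [inner_compress, inner_compress, inner_compress, mul_apply_eq_comp, mul_apply_eq_comp,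
    star_eq_adjoint, adjoint_inner_left, h, h]

theorem isMultiplicativeDilation (hcov : ∀ a : A, compress V (π a) = π (Φ a))
    (hdil : IsMinimalUnitaryDilation V U Z) {B : StarSubalgebra ℂ (L →L[ℂ] L)}
    (hB : dilationGenerators π U Z ⊆ B) (hc : ∀ X ∈ B, compress Z X ∈ π.range) (Θ : B →⋆ₐ[ℂ] B)
    (hΘ : ∀ X : B, (Θ X : L →L[ℂ] L) = star (U : L →L[ℂ] L) * X * (U : L →L[ℂ] L)) :
    IsMultiplicativeDilation Φ π Θ Z := by
  have key : ∀ (n : ℕ) (X : B) (a : A), compress Z X = π a →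
      compress Z (Θ^[n] X : B) = π (Φ^[n] a) := fun n X a h => by
    induction n with
    | zero => exact h
    | succ n ih =>
      rw [Function.iterate_succ_apply', Function.iterate_succ_apply', hΘ, compress_conj hdil, ih,
        hcov]
  exact ⟨fun a => hB (inflate_mem_dilationGenerators a), fun X => hc X X.2,
    fun n a => (key n ⟨_, hB (inflate_mem_dilationGenerators a)⟩ a (compress_inflate Z (π a))).symm, key⟩

/-- The *-endomorphism `X ↦ U* X U` of a *-subalgebra that it leaves invariant. -/
theorem exists_conj_starAlgHom (U : unitary (L →L[ℂ] L)) (B : StarSubalgebra ℂ (L →L[ℂ] L))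
    (hB : ∀ X ∈ B, star (U : L →L[ℂ] L) * X * U ∈ B) :
    ∃ Θ : B →⋆ₐ[ℂ] B,
      ∀ X : B, (Θ X : L →L[ℂ] L) = star (U : L →L[ℂ] L) * X * (U : L →L[ℂ] L) := by
  let c : (L →L[ℂ] L) →⋆ₐ[ℂ] (L →L[ℂ] L) :=
    (Unitary.conjStarAlgAut ℂ (L →L[ℂ] L) U).symm
  exact ⟨(c.comp B.subtype).codRestrict B fun X => hB X X.2, fun X => rfl⟩

theorem conj_mem_adjoin {X : L →L[ℂ] L}
    (hX : X ∈ StarAlgebra.adjoin ℂ (dilationGenerators π U Z)) :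
    star (U : L →L[ℂ] L) * X * U ∈ StarAlgebra.adjoin ℂ (dilationGenerators π U Z) := by
  let c : (L →L[ℂ] L) →⋆ₐ[ℂ] (L →L[ℂ] L) :=
    (Unitary.conjStarAlgAut ℂ (L →L[ℂ] L) U).symm
  exact StarAlgebra.adjoin_le (S := (StarAlgebra.adjoin ℂ (dilationGenerators π U Z)).comap c)
    (fun X hX => StarAlgebra.subset_adjoin _ _ (star_mul_generator_mul_mem hX)) hX

theorem conj_mem_topologicalClosure_adjoin {X : L →L[ℂ] L}
    (hX : X ∈ (StarAlgebra.adjoin ℂ (dilationGenerators π U Z)).topologicalClosure) :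
    star (U : L →L[ℂ] L) * X * U ∈
      (StarAlgebra.adjoin ℂ (dilationGenerators π U Z)).topologicalClosure := by
  let c : (L →L[ℂ] L) →⋆ₐ[ℂ] (L →L[ℂ] L) :=
    (Unitary.conjStarAlgAut ℂ (L →L[ℂ] L) U).symm
  have hc : Continuous c := by
    change Continuous fun X : L →L[ℂ] L => star (U : L →L[ℂ] L) * X * U
    fun_prop
  refine StarSubalgebra.topologicalClosure_minimal
    (t := (StarAlgebra.adjoin ℂ (dilationGenerators π U Z)).topologicalClosure.comap c)
    (fun X hX => ?_) ((StarSubalgebra.isClosed_topologicalClosure _).preimage hc) hX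
  exact StarSubalgebra.le_topologicalClosure _ (conj_mem_adjoin hX)

theorem injective_of_isStinespringRepresentation {E : ℕ → Submodule ℂ K} {j : H →ₗᵢ[ℂ] K}
    (h : IsStinespringRepresentation A Φ π V E j) : Function.Injective π := by
  refine (injective_iff_map_eq_zero π).mpr fun a ha => Subtype.ext (ContinuousLinearMap.ext fun x => ?_)
  refine j.injective ?_
  rw [← h.apply_zero, ha]
  simp

theorem isClosed_range_of_injective [IsClosed (A : Set (H →L[ℂ] H))]
    (hπ : Function.Injective π) : IsClosed (π.range : Set (K →L[ℂ] K)) := by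
  have h : (π.range : Set (K →L[ℂ] K)) = Set.range π := by
    ext
    rfl
  rw [h]
  exact (NonUnitalStarAlgHom.isometry π hπ).isClosedEmbedding.isClosed_range

theorem continuous_compress (Z : K →ₗᵢ[ℂ] L) : Continuous (compress Z) := by
  unfold compress
  fun_prop

end MultiplicativeDilation

/-- The algebra is the norm closure of the *-algebra of generators. Compression is norm continuous
and π has closed range, so compressions stay in π(A). -/
theorem exists_cstar_dilation {H : Type u} [NormedAddCommGroup H] [InnerProductSpace ℂ H]
    [CompleteSpace H] (A : StarSubalgebra ℂ (H →L[ℂ] H)) [IsClosed (A : Set (H →L[ℂ] H))]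
    (Φ : A →CP A) (hΦ : Φ 1 = 1) :
      ∃ (K : Type u) (_ : NormedAddCommGroup K) (_ : InnerProductSpace ℂ K) (_ : CompleteSpace K)
        (π : A →⋆ₐ[ℂ] (K →L[ℂ] K)) (V : K →ₗᵢ[ℂ] K) (E : ℕ → Submodule ℂ K) (j : H →ₗᵢ[ℂ] K)
        (K' : Type u) (_ : NormedAddCommGroup K') (_ : InnerProductSpace ℂ K')
        (_ : CompleteSpace K') (U : unitary (K' →L[ℂ] K')) (Z : K →ₗᵢ[ℂ] K')
        (B : StarSubalgebra ℂ (K' →L[ℂ] K')) (Θ : B →⋆ₐ[ℂ] B),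
        Function.Injective π ∧
        UcpDilation.IsStinespringRepresentation A Φ π V E j ∧
        UcpDilation.IsMinimalUnitaryDilation V U Z ∧
        IsClosed (B : Set (K' →L[ℂ] K')) ∧
        (∀ X : B, (Θ X : K' →L[ℂ] K') = star (U : K' →L[ℂ] K') * X * (U : K' →L[ℂ] K')) ∧
        UcpDilation.IsMultiplicativeDilation Φ π Θ Z := by
  obtain ⟨K, _, _, _, π, V, E, j, hst⟩ := exists_isStinespringRepresentation Φ hΦ
  obtain ⟨K', _, _, _, U, Z, hdil⟩ := exists_isMinimalUnitaryDilation V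
  have hπ := injective_of_isStinespringRepresentation hst
  let B := (StarAlgebra.adjoin ℂ (dilationGenerators π U Z)).topologicalClosure
  obtain ⟨Θ, hΘ⟩ := exists_conj_starAlgHom U B fun X hX => conj_mem_topologicalClosure_adjoin hX
  refine ⟨K, _, _, ‹_›, π, V, E, j, K', _, _, ‹_›, U, Z, B, Θ, hπ, hst, hdil,
    StarSubalgebra.isClosed_topologicalClosure _, hΘ, ?_⟩
  refine isMultiplicativeDilation hst.covariant hdil ?_ (fun X hX => ?_) Θ hΘ
  · exact fun X hX => StarSubalgebra.le_topologicalClosure _ (StarAlgebra.subset_adjoin _ _ hX)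
  · have := map_mem_closure (continuous_compress Z) hX fun X hX =>
      compress_mem_range hst.covariant hdil hX
    rwa [(isClosed_range_of_injective hπ).closure_eq] at this

/-! ### Bounded increasing nets of operators and their suprema -/

section MonotoneNets

open ContinuousLinearMap Filter Topology

variable {H : Type*} [NormedAddCommGroup H] [InnerProductSpace ℂ H] [CompleteSpace H]

omit [CompleteSpace H] in
theorem re_inner_nonneg {D : H →L[ℂ] H} (hD : 0 ≤ D) (x : H) : 0 ≤ (⟪D x, x⟫_ℂ).re :=
  ((nonneg_iff_isPositive D).mp hD).re_inner_nonneg_left x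

theorem re_inner_mono {S T : H →L[ℂ] H} (h : S ≤ T) (x : H) :
    (⟪S x, x⟫_ℂ).re ≤ (⟪T x, x⟫_ℂ).re := by
  have := re_inner_nonneg (sub_nonneg.mpr h) x
  rw [sub_apply, inner_sub_left, Complex.sub_re] at this
  linarith

/-- Write D = c* c. The inequality upgrades convergence of quadratic forms to strong convergence. -/
theorem norm_apply_sq_le {D : H →L[ℂ] H} (hD : 0 ≤ D) (x : H) :
    ‖D x‖ ^ 2 ≤ ‖D‖ * (⟪D x, x⟫_ℂ).re := by
  obtain ⟨c, rfl⟩ := exists_star_mul_self hD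
  have h1 : (⟪(star c * c) x, x⟫_ℂ).re = ‖c x‖ ^ 2 := by
    rw [mul_apply_eq_comp, star_eq_adjoint, adjoint_inner_left]
    exact inner_self_eq_norm_sq (𝕜 := ℂ) _
  have h2 : ‖(star c * c) x‖ ≤ ‖c‖ * ‖c x‖ := by
    rw [mul_apply_eq_comp, ← norm_star c]
    exact le_opNorm _ _
  rw [h1, CStarRing.norm_star_mul_self]
  calc ‖(star c * c) x‖ ^ 2 ≤ (‖c‖ * ‖c x‖) ^ 2 := by gcongr
    _ = _ := by ring

omit [CompleteSpace H] in
theorem nonneg_of_tendsto {ι : Type*} {l : Filter ι} [l.NeBot] {D : ι → H →L[ℂ] H}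
    {T : H →L[ℂ] H} (hD : ∀ᶠ i in l, 0 ≤ D i) (h : ∀ x, Tendsto (fun i => D i x) l (𝓝 (T x))) :
    0 ≤ T := by
  rw [nonneg_iff_isPositive, isPositive_iff_complex]
  intro x
  have h1 : Tendsto (fun i => ⟪D i x, x⟫_ℂ) l (𝓝 ⟪T x, x⟫_ℂ) := (h x).inner tendsto_const_nhds
  have hc : IsClosed {z : ℂ | (z.re : ℂ) = z ∧ 0 ≤ z.re} :=
    (isClosed_eq (Complex.continuous_ofReal.comp Complex.continuous_re) continuous_id).inter
      (isClosed_le continuous_const Complex.continuous_re)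
  refine hc.mem_of_tendsto h1 (hD.mono fun i hi => ?_)
  rw [nonneg_iff_isPositive, isPositive_iff_complex] at hi
  exact hi x

section

variable {S : Set (H →L[ℂ] H)} (hne : S.Nonempty) (hdir : DirectedOn (· ≤ ·) S)

include hne hdir in
/-- A bounded increasing net of operators converges strongly. -/
theorem exists_tendsto_of_directedOn {b : H →L[ℂ] H} (hb : ∀ s ∈ S, s ≤ b) :
    ∃ T : H →L[ℂ] H, ∀ x, Tendsto (fun s : S => (s : H →L[ℂ] H) x) atTop (𝓝 (T x)) := by
  have : Nonempty S := hne.to_subtype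
  have : IsDirectedOrder S := ⟨fun s t => by
    obtain ⟨r, hr, h1, h2⟩ := hdir s s.2 t t.2
    exact ⟨⟨r, hr⟩, h1, h2⟩⟩
  obtain ⟨s₀, hs₀⟩ := hne
  have hC : ∀ s ∈ S, ∀ t ∈ S, s₀ ≤ s → s ≤ t → ‖t - s‖ ≤ ‖b - s₀‖ := fun s hs t ht h0 h1 =>
    CStarAlgebra.norm_le_norm_of_nonneg_of_le (sub_nonneg.mpr h1)
      (sub_le_sub (hb t ht) h0)
  have hcauchy : ∀ x, ∃ y, Tendsto (fun s : S => (s : H →L[ℂ] H) x) atTop (𝓝 y) := fun x => by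
    refine cauchy_map_iff_exists_tendsto.mp ?_
    rw [Metric.cauchy_iff]
    refine ⟨map_neBot, fun ε hε => ?_⟩
    let q : S → ℝ := fun s => (⟪(s : H →L[ℂ] H) x, x⟫_ℂ).re
    have hq : Monotone q := fun s t hst => re_inner_mono hst x
    have hbdd : BddAbove (Set.range q) := ⟨(⟪b x, x⟫_ℂ).re, by
      rintro _ ⟨s, rfl⟩
      exact re_inner_mono (hb s s.2) x⟩
    -- Beyond both `s₁` and `s₀`, increments have norm at most ‖b − s₀‖ and form at x below this
    -- gap, so `norm_apply_sq_le` bounds the squared displacement of x by (ε/2)².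
    obtain ⟨s₁, hs₁⟩ := exists_lt_of_lt_ciSup (f := q)
      (sub_lt_self (⨆ s, q s) (show 0 < (ε / 2) ^ 2 / (‖b - s₀‖ + 1) by positivity))
    obtain ⟨s₂, h12, h02⟩ := exists_ge_ge s₁ ⟨s₀, hs₀⟩
    have key : ∀ t : S, s₂ ≤ t → dist ((t : H →L[ℂ] H) x) ((s₂ : H →L[ℂ] H) x) < ε / 2 := by
      intro t ht
      rw [dist_eq_norm, ← sub_apply]
      refine lt_of_pow_lt_pow_left₀ 2 (by positivity) ?_
      refine (norm_apply_sq_le (sub_nonneg.mpr (show (s₂ : H →L[ℂ] H) ≤ t from ht)) x).trans_lt ?_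
      have h1 : (⟪((t : H →L[ℂ] H) - s₂) x, x⟫_ℂ).re < (ε / 2) ^ 2 / (‖b - s₀‖ + 1) := by
        rw [sub_apply, inner_sub_left, Complex.sub_re]
        have h2 : q t ≤ ⨆ s, q s := le_ciSup hbdd t
        have h3 : q s₁ ≤ q s₂ := hq h12
        change q t - q s₂ < _
        linarith
      have h0 := re_inner_nonneg (sub_nonneg.mpr (show (s₂ : H →L[ℂ] H) ≤ t from ht)) x
      have h4 := hC s₂ s₂.2 t t.2 h02 ht
      rw [lt_div_iff₀ (by positivity)] at h1
      nlinarith [norm_nonneg ((t : H →L[ℂ] H) - s₂)]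
    refine ⟨_, image_mem_map (Ici_mem_atTop s₂), ?_⟩
    rintro _ ⟨s, hs, rfl⟩ _ ⟨t, ht, rfl⟩
    have h1 := key s hs
    have h2 := key t ht
    have := dist_triangle_right ((s : H →L[ℂ] H) x) ((t : H →L[ℂ] H) x) ((s₂ : H →L[ℂ] H) x)
    linarith
  choose f hf using hcauchy
  let T₀ : H →ₗ[ℂ] H := linearMapOfTendsto f
    (fun s : S => ((s : H →L[ℂ] H) : H →ₗ[ℂ] H)) (tendsto_pi_nhds.mpr hf)
  refine ⟨T₀.mkContinuous (‖s₀‖ + ‖b - s₀‖) fun x => ?_, hf⟩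
  refine le_of_tendsto (hf x).norm ?_
  filter_upwards [Ici_mem_atTop (⟨s₀, hs₀⟩ : S)] with s hs
  refine (le_opNorm _ _).trans ?_
  gcongr
  have h1 := hC s₀ hs₀ s s.2 le_rfl hs
  calc ‖(s : H →L[ℂ] H)‖ = ‖s₀ + (s - s₀)‖ := by rw [add_sub_cancel]
    _ ≤ _ := (norm_add_le _ _).trans (by gcongr)

include hne hdir in
theorem isLUB_of_tendsto {T : H →L[ℂ] H}
    (h : ∀ x, Tendsto (fun s : S => (s : H →L[ℂ] H) x) atTop (𝓝 (T x))) : IsLUB S T := by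
  have : Nonempty S := hne.to_subtype
  have : IsDirectedOrder S := ⟨fun s t => by
    obtain ⟨r, hr, h1, h2⟩ := hdir s s.2 t t.2
    exact ⟨⟨r, hr⟩, h1, h2⟩⟩
  refine ⟨fun s hs => ?_, fun b hb => ?_⟩
  · rw [← sub_nonneg]
    refine nonneg_of_tendsto (l := (atTop : Filter S)) (D := fun t => (t : H →L[ℂ] H) - s) ?_
      fun x => ?_
    · filter_upwards [Ici_mem_atTop (⟨s, hs⟩ : S)] with t ht
      exact sub_nonneg.mpr ht
    · exact (h x).sub_const _
  · rw [← sub_nonneg]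
    refine nonneg_of_tendsto (l := (atTop : Filter S)) (D := fun t => b - (t : H →L[ℂ] H)) ?_
      fun x => ?_
    · exact Eventually.of_forall fun t => sub_nonneg.mpr (hb t.2)
    · exact (h x).const_sub _

include hne hdir in
theorem tendsto_of_isLUB {T : H →L[ℂ] H} (hT : IsLUB S T) (x : H) :
    Tendsto (fun s : S => (s : H →L[ℂ] H) x) atTop (𝓝 (T x)) := by
  obtain ⟨T', hT'⟩ := exists_tendsto_of_directedOn hne hdir hT.1
  rw [hT.unique (isLUB_of_tendsto hne hdir hT')]
  exact hT' x

include hne hdir in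
theorem exists_norm_sub_apply_lt {T : H →L[ℂ] H} (hT : IsLUB S T) (x y : H) {ε : ℝ}
    (hε : 0 < ε) : ∃ s ∈ S, ‖(T - s) x‖ < ε ∧ ‖(T - s) y‖ < ε := by
  have : Nonempty S := hne.to_subtype
  have : IsDirectedOrder S := ⟨fun s t => by
    obtain ⟨r, hr, h1, h2⟩ := hdir s s.2 t t.2
    exact ⟨⟨r, hr⟩, h1, h2⟩⟩
  have h : ∀ x, ∀ᶠ s : S in atTop, ‖(T - s) x‖ < ε := fun x => by
    filter_upwards [Metric.tendsto_nhds.mp (tendsto_of_isLUB hne hdir hT x) ε hε] with s hs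
    rwa [dist_comm, dist_eq_norm] at hs
  obtain ⟨s, h1, h2⟩ := ((h x).and (h y)).exists
  exact ⟨s, s.2, h1, h2⟩

include hne hdir in
theorem exists_re_inner_lt {T : H →L[ℂ] H} (hT : IsLUB S T) (x : H) {ε : ℝ}
    (hε : 0 < ε) : ∃ s ∈ S, (⟪(T - s) x, x⟫_ℂ).re < ε := by
  obtain ⟨s, hs, h, -⟩ := exists_norm_sub_apply_lt hne hdir hT x x
    (show 0 < ε / (‖x‖ + 1) by positivity)
  refine ⟨s, hs, ?_⟩
  rw [lt_div_iff₀ (by positivity)] at h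
  have h1 : (⟪(T - s) x, x⟫_ℂ).re ≤ ‖(T - s) x‖ * ‖x‖ :=
    (Complex.re_le_norm _).trans (norm_inner_le_norm _ _)
  nlinarith [norm_nonneg ((T - s) x)]

end

theorem isLUB_of_re_inner_lt {S : Set (H →L[ℂ] H)} {T : H →L[ℂ] H} (hT : ∀ s ∈ S, s ≤ T)
    (h : ∀ x, ∀ ε > 0, ∃ s ∈ S, (⟪(T - s) x, x⟫_ℂ).re < ε) : IsLUB S T := by
  refine ⟨hT, fun b hb => ?_⟩
  obtain ⟨s, hs, -⟩ := h 0 1 one_pos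
  -- Neither b nor T need be self-adjoint, but both differ from the same s by a positive operator.
  have hsym : IsSelfAdjoint (b - T) := by
    rw [← sub_sub_sub_cancel_right b T s]
    exact (IsSelfAdjoint.of_nonneg (sub_nonneg.mpr (hb hs))).sub
      (IsSelfAdjoint.of_nonneg (sub_nonneg.mpr (hT s hs)))
  rw [← sub_nonneg, nonneg_iff_isPositive, isPositive_def']
  refine ⟨hsym, fun x => ?_⟩
  change 0 ≤ (⟪(b - T) x, x⟫_ℂ).re
  refine le_of_forall_pos_lt_add fun ε hε => ?_
  obtain ⟨s, hs, hlt⟩ := h x ε hε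
  have h1 := re_inner_nonneg (sub_nonneg.mpr (hb hs)) x
  rw [← sub_add_sub_cancel b T s, add_apply, inner_add_left, Complex.add_re] at h1
  linarith

theorem isLUB_conj {S : Set (H →L[ℂ] H)} (hne : S.Nonempty) (hdir : DirectedOn (· ≤ ·) S)
    {T : H →L[ℂ] H} (hT : IsLUB S T) (b : H →L[ℂ] H) :
    IsLUB ((fun s => star b * s * b) '' S) (star b * T * b) := by
  refine isLUB_of_re_inner_lt ?_ fun x ε hε => ?_
  · rintro _ ⟨s, hs, rfl⟩
    exact star_left_conjugate_le_conjugate (hT.1 hs) b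
  · obtain ⟨s, hs, h⟩ := exists_re_inner_lt hne hdir hT (b x) hε
    refine ⟨_, ⟨s, hs, rfl⟩, ?_⟩
    rw [← sub_mul, ← mul_sub, mul_assoc, mul_apply_eq_comp, mul_apply_eq_comp, star_eq_adjoint,
      adjoint_inner_left]
    exact h

/-- The forms of T − s decrease along the net and are bounded by ‖T − s₀‖ beyond s₀; the
parallelogram law then carries smallness to sums and to limits. Normality therefore needs checking
only on a total set of vectors. -/
theorem re_inner_lt_of_mem_closure_span {S : Set (H →L[ℂ] H)} (hne : S.Nonempty)
    (hdir : DirectedOn (· ≤ ·) S) {T : H →L[ℂ] H} (hT : ∀ s ∈ S, s ≤ T) {X : Set H}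
    (hX : ∀ x ∈ X, ∀ ε > 0, ∃ s ∈ S, (⟪(T - s) x, x⟫_ℂ).re < ε) :
    ∀ x ∈ (Submodule.span ℂ X).topologicalClosure, ∀ ε > 0, ∃ s ∈ S,
      (⟪(T - s) x, x⟫_ℂ).re < ε := by
  have hpar : ∀ s ∈ S, ∀ x y, (⟪(T - s) (x + y), x + y⟫_ℂ).re ≤
      2 * (⟪(T - s) x, x⟫_ℂ).re + 2 * (⟪(T - s) y, y⟫_ℂ).re := fun s hs x y => by
    have := re_inner_nonneg (sub_nonneg.mpr (hT s hs)) (x - y)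
    simp only [map_add, map_sub, inner_add_left, inner_add_right, inner_sub_left, inner_sub_right,
      Complex.add_re, Complex.sub_re] at this ⊢
    linarith
  have hspan : ∀ x ∈ Submodule.span ℂ X, ∀ ε > 0, ∃ s ∈ S, (⟪(T - s) x, x⟫_ℂ).re < ε := by
    intro x hx
    induction hx using Submodule.span_induction with
    | mem x hx => exact hX x hx
    | zero =>
      intro ε hε
      obtain ⟨s, hs⟩ := hne
      exact ⟨s, hs, by simpa using hε⟩
    | add x y _ _ hx hy =>
      intro ε hε
      obtain ⟨s, hs, h1⟩ := hx (ε / 4) (by positivity)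
      obtain ⟨t, ht, h2⟩ := hy (ε / 4) (by positivity)
      obtain ⟨r, hr, hsr, htr⟩ := hdir s hs t ht
      refine ⟨r, hr, (hpar r hr x y).trans_lt ?_⟩
      have h3 := re_inner_mono (sub_le_sub_left hsr T) x
      have h4 := re_inner_mono (sub_le_sub_left htr T) y
      linarith
    | smul c x _ hx =>
      intro ε hε
      obtain ⟨s, hs, h⟩ := hx (ε / (‖c‖ ^ 2 + 1)) (by positivity)
      refine ⟨s, hs, ?_⟩
      have h0 := re_inner_nonneg (sub_nonneg.mpr (hT s hs)) x
      rw [lt_div_iff₀ (by positivity)] at h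
      have : (⟪(T - s) (c • x), c • x⟫_ℂ).re = ‖c‖ ^ 2 * (⟪(T - s) x, x⟫_ℂ).re := by
        rw [map_smul, inner_smul_left, inner_smul_right, ← mul_assoc, Complex.conj_mul',
          ← Complex.ofReal_pow, Complex.re_ofReal_mul]
      rw [this]
      nlinarith
  intro x hx ε hε
  obtain ⟨s₀, hs₀⟩ := hne
  -- Chosen so that 2‖T − s₀‖‖x − y‖² stays below ε/2; the other half is twice the ε/4 obtained at
  -- y.
  have hδ : 0 < √(ε / (4 * (‖T - s₀‖ + 1))) := by positivity
  obtain ⟨y, hy, hxy⟩ := Metric.mem_closure_iff.mp hx _ hδ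
  obtain ⟨s, hs, h1⟩ := hspan y hy (ε / 4) (by positivity)
  obtain ⟨r, hr, hsr, h0r⟩ := hdir s hs s₀ hs₀
  refine ⟨r, hr, ?_⟩
  have h2 := hpar r hr y (x - y)
  rw [add_sub_cancel] at h2
  have h3 := re_inner_mono (sub_le_sub_left hsr T) y
  have h4 : (⟪(T - r) (x - y), x - y⟫_ℂ).re ≤ ‖T - s₀‖ * ‖x - y‖ ^ 2 := by
    refine (re_inner_mono (sub_le_sub_left h0r T) _).trans ?_
    refine (Complex.re_le_norm _).trans ((norm_inner_le_norm _ _).trans ?_)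
    rw [pow_two, ← mul_assoc]
    gcongr
    exact le_opNorm _ _
  rw [dist_eq_norm, Real.lt_sqrt (norm_nonneg _), lt_div_iff₀ (by positivity)] at hxy
  nlinarith [sq_nonneg ‖x - y‖, norm_nonneg (T - s₀)]

end MonotoneNets

/-! ### Two-vector density theorem -/

section Density

open ContinuousLinearMap

variable {L : Type*} [NormedAddCommGroup L] [InnerProductSpace ℂ L] [CompleteSpace L]

/-- The operator `X ⊕ X` on `L ⊕ L`. -/
noncomputable def doubleOp : (L →L[ℂ] L) →ₗ[ℂ] (WithLp 2 (L × L) →L[ℂ] WithLp 2 (L × L)) where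
  toFun X := (WithLp.prodContinuousLinearEquiv 2 ℂ L L).symm.toContinuousLinearMap ∘L
    (X.prodMap X) ∘L (WithLp.prodContinuousLinearEquiv 2 ℂ L L).toContinuousLinearMap
  map_add' _ _ := rfl
  map_smul' _ _ := rfl

omit [CompleteSpace L] in
theorem doubleOp_apply (X : L →L[ℂ] L) (v : WithLp 2 (L × L)) :
    doubleOp X v = WithLp.toLp 2 (X v.fst, X v.snd) := rfl

theorem inner_doubleOp (X : L →L[ℂ] L) (v v' : WithLp 2 (L × L)) :
    ⟪doubleOp X v, v'⟫_ℂ = ⟪v, doubleOp (star X) v'⟫_ℂ := by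
  simp [WithLp.prod_inner_apply, doubleOp_apply, star_eq_adjoint, adjoint_inner_right]

/-- Density theorem for two vectors: the elements of the double commutant of a unital *-algebra
of operators can be approximated by elements of the algebra on any two vectors. -/
theorem exists_approx_of_mem_centralizer_centralizer (B : StarSubalgebra ℂ (L →L[ℂ] L))
    {X : L →L[ℂ] L} (hX : X ∈ Set.centralizer (Set.centralizer (B : Set (L →L[ℂ] L))))
    (ξ η : L) {ε : ℝ} (hε : 0 < ε) : ∃ Y ∈ B, ‖(X - Y) ξ‖ < ε ∧ ‖(X - Y) η‖ < ε := by
  let v : WithLp 2 (L × L) := WithLp.toLp 2 (ξ, η)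
  let ev : (L →L[ℂ] L) →ₗ[ℂ] WithLp 2 (L × L) :=
    { toFun := fun Y => doubleOp Y v
      map_add' := fun _ _ => rfl
      map_smul' := fun _ _ => rfl }
  let W₀ : Submodule ℂ (WithLp 2 (L × L)) := B.toSubalgebra.toSubmodule.map ev
  let W := W₀.topologicalClosure
  have hWc : IsClosed (W : Set (WithLp 2 (L × L))) := Submodule.isClosed_topologicalClosure _
  have : CompleteSpace W := hWc.completeSpace_coe
  have hinv : ∀ Y ∈ B, ∀ u ∈ W, doubleOp Y u ∈ W := fun Y hY u hu => by
    have h : W ≤ W.comap (doubleOp Y).toLinearMap := by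
      refine Submodule.topologicalClosure_minimal _ ?_ (hWc.preimage (doubleOp Y).continuous)
      rintro _ ⟨Y', hY', rfl⟩
      exact Submodule.le_topologicalClosure _ ⟨Y * Y', B.mul_mem hY hY', rfl⟩
    exact h hu
  have hinv' : ∀ Y ∈ B, ∀ u ∈ Wᗮ, doubleOp Y u ∈ Wᗮ := fun Y hY u hu => by
    rw [Submodule.mem_orthogonal']
    intro z hz
    rw [inner_doubleOp]
    exact Submodule.inner_left_of_mem_orthogonal (hinv _ (star_mem hY) z hz) hu
  have hcomm : ∀ Y ∈ B, ∀ u, W.starProjection (doubleOp Y u) =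
      doubleOp Y (W.starProjection u) := fun Y hY u => by
    refine Submodule.eq_starProjection_of_mem_orthogonal ?_ ?_
    · exact hinv Y hY _ (Submodule.starProjection_apply_mem W u)
    · rw [← map_sub]
      exact hinv' Y hY _ (Submodule.sub_starProjection_mem_orthogonal u)
  let e₁ : L →L[ℂ] WithLp 2 (L × L) :=
    (WithLp.prodContinuousLinearEquiv 2 ℂ L L).symm.toContinuousLinearMap ∘L inl ℂ L L
  let e₂ : L →L[ℂ] WithLp 2 (L × L) :=
    (WithLp.prodContinuousLinearEquiv 2 ℂ L L).symm.toContinuousLinearMap ∘L inr ℂ L L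
  let p₁ : WithLp 2 (L × L) →L[ℂ] L :=
    fst ℂ L L ∘L (WithLp.prodContinuousLinearEquiv 2 ℂ L L).toContinuousLinearMap
  let p₂ : WithLp 2 (L × L) →L[ℂ] L :=
    snd ℂ L L ∘L (WithLp.prodContinuousLinearEquiv 2 ℂ L L).toContinuousLinearMap
  have he₁ : ∀ (Y : L →L[ℂ] L) x, doubleOp Y (e₁ x) = e₁ (Y x) := fun Y x => by
    rw [doubleOp_apply]
    change WithLp.toLp 2 (Y x, Y 0) = WithLp.toLp 2 (Y x, 0)
    rw [map_zero]
  have he₂ : ∀ (Y : L →L[ℂ] L) x, doubleOp Y (e₂ x) = e₂ (Y x) := fun Y x => by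
    rw [doubleOp_apply]
    change WithLp.toLp 2 (Y 0, Y x) = WithLp.toLp 2 (0, Y x)
    rw [map_zero]
  have hv : ∀ x y : L, WithLp.toLp 2 (x, y) = e₁ x + e₂ y := fun x y => by
    change _ = WithLp.toLp 2 (x + 0, 0 + y)
    rw [add_zero, zero_add]
  -- The projection onto W commutes with Y ⊕ Y for Y in B, so its matrix entries lie in the
  -- commutant of B and hence commute with X. Thus X ⊕ X commutes with the projection, and it maps
  -- v, which lies in W because 1 ∈ B, into W.
  have hcent : ∀ (p : WithLp 2 (L × L) →L[ℂ] L) (e : L →L[ℂ] WithLp 2 (L × L)),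
      (∀ (Y : L →L[ℂ] L) u, p (doubleOp Y u) = Y (p u)) →
      (∀ (Y : L →L[ℂ] L) x, doubleOp Y (e x) = e (Y x)) →
      ∀ x, X (p (W.starProjection (e x))) = p (W.starProjection (e (X x))) := by
    intro p e hp he x
    have h : p ∘L W.starProjection ∘L e ∈ Set.centralizer (B : Set (L →L[ℂ] L)) := fun Y hY => by
      ext x
      simp only [mul_apply_eq_comp, comp_apply]
      rw [← hp, ← hcomm Y hY, he]
    exact (congrArg (fun T : L →L[ℂ] L => T x) (hX _ h)).symm
  have hPv : W.starProjection v = v := by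
    rw [Submodule.starProjection_eq_self_iff]
    exact Submodule.le_topologicalClosure _ ⟨1, B.one_mem, rfl⟩
  have hXv : W.starProjection (doubleOp X v) = doubleOp X v := by
    have h : ∀ p : WithLp 2 (L × L) →L[ℂ] L, (∀ (Y : L →L[ℂ] L) u, p (doubleOp Y u) = Y (p u)) →
        p (W.starProjection (doubleOp X v)) = p (doubleOp X v) := by
      intro p hp
      rw [hp, doubleOp_apply, hv, map_add, map_add, ← hcent p e₁ hp he₁, ← hcent p e₂ hp he₂,
        ← map_add, ← map_add, ← map_add]
      change X (p (W.starProjection (e₁ ξ + e₂ η))) = _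
      rw [← hv, hPv]
    refine (WithLp.prodContinuousLinearEquiv 2 ℂ L L).injective (Prod.ext ?_ ?_)
    · exact h p₁ fun Y u => rfl
    · exact h p₂ fun Y u => rfl
  rw [Submodule.starProjection_eq_self_iff] at hXv
  obtain ⟨_, ⟨Y, hY, rfl⟩, hlt⟩ := Metric.mem_closure_iff.mp hXv ε hε
  have hsub : dist (doubleOp X v) (ev Y) = ‖WithLp.toLp 2 ((X - Y) ξ, (X - Y) η)‖ := by
    rw [dist_eq_norm]
    rfl
  rw [hsub] at hlt
  exact ⟨Y, hY, (WithLp.norm_fst_le _ _).trans_lt hlt, (WithLp.norm_snd_le _ _).trans_lt hlt⟩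

end Density

/-! ### Normality of the Stinespring representation -/

section NormalRepresentations

open ContinuousLinearMap

variable {H K : Type*} [NormedAddCommGroup H] [InnerProductSpace ℂ H] [CompleteSpace H]
  [NormedAddCommGroup K] [InnerProductSpace ℂ K] [CompleteSpace K]

theorem starAlgHom_mono {A : StarSubalgebra ℂ (H →L[ℂ] H)} [IsClosed (A : Set (H →L[ℂ] H))]
    (π : A →⋆ₐ[ℂ] (K →L[ℂ] K)) {a b : A} (h : a ≤ b) : π a ≤ π b := by
  obtain ⟨c, hc⟩ := exists_star_mul_self (sub_nonneg.mpr h)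
  rw [← sub_nonneg, ← map_sub, hc, map_mul, map_star]
  exact star_mul_self_nonneg _

theorem completelyPositiveMap_mono {A : StarSubalgebra ℂ (H →L[ℂ] H)}
    [IsClosed (A : Set (H →L[ℂ] H))] (Φ : A →CP A) {a b : A} (h : a ≤ b) : Φ a ≤ Φ b :=
  OrderHomClass.mono Φ h

theorem directedOn_image_of_monotone {α β : Type*} [Preorder α] [Preorder β] {f : α → β}
    (hf : Monotone f) {S : Set α} (hS : DirectedOn (· ≤ ·) S) : DirectedOn (· ≤ ·) (f '' S) := by
  rintro _ ⟨s, hs, rfl⟩ _ ⟨t, ht, rfl⟩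
  obtain ⟨r, hr, h1, h2⟩ := hS s hs t ht
  exact ⟨f r, ⟨r, hr, rfl⟩, hf h1, hf h2⟩

theorem directedOn_coe_image {A : StarSubalgebra ℂ (H →L[ℂ] H)} {S : Set A}
    (hS : DirectedOn (· ≤ ·) S) :
    DirectedOn (· ≤ ·) ((fun s : A => (s : H →L[ℂ] H)) '' S) :=
  directedOn_image_of_monotone (f := fun s : A => (s : H →L[ℂ] H)) (fun _ _ h => h) hS

theorem isNormalMap_of_total {A : StarSubalgebra ℂ (H →L[ℂ] H)}
    [IsClosed (A : Set (H →L[ℂ] H))] {π : A →⋆ₐ[ℂ] (K →L[ℂ] K)} {X : Set K}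
    (hX : (Submodule.span ℂ X).topologicalClosure = ⊤)
    (h : ∀ (S : Set A) (a : A), S.Nonempty → DirectedOn (· ≤ ·) S → (∀ s ∈ S, IsSelfAdjoint s) →
      IsLUB ((fun s : A => (s : H →L[ℂ] H)) '' S) (a : H →L[ℂ] H) →
      ∀ x ∈ X, ∀ ε > 0, ∃ s ∈ S, (⟪π (a - s) x, x⟫_ℂ).re < ε) :
    IsNormalMap (fun a => π a) := by
  intro S a hne hdir hsa hlub
  have hub : ∀ s ∈ S, s ≤ a := fun s hs => hlub.1 ⟨s, hs, rfl⟩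
  have hub' : ∀ s ∈ (fun a => π a) '' S, s ≤ π a := by
    rintro _ ⟨s, hs, rfl⟩
    exact starAlgHom_mono π (hub s hs)
  refine isLUB_of_re_inner_lt hub' fun x => ?_
  refine re_inner_lt_of_mem_closure_span (hne.image _)
    (directedOn_image_of_monotone (fun _ _ h => starAlgHom_mono π h) hdir) hub' (X := X) ?_ x
    (hX ▸ Submodule.mem_top)
  intro x hx ε hε
  obtain ⟨s, hs, hlt⟩ := h S a hne hdir hsa hlub x hx ε hε
  exact ⟨_, ⟨s, hs, rfl⟩, by rwa [← map_sub]⟩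

/-- The representation in the iterated Stinespring representation of a normal map is normal. -/
theorem isNormalMap_of_isStinespringRepresentation {A : StarSubalgebra ℂ (H →L[ℂ] H)}
    [IsClosed (A : Set (H →L[ℂ] H))] {Φ : A →CP A}
    (hΦ : IsNormalMap (fun a => (Φ a : H →L[ℂ] H))) {π : A →⋆ₐ[ℂ] (K →L[ℂ] K)} {V : K →ₗᵢ[ℂ] K}
    {E : ℕ → Submodule ℂ K} {j : H →ₗᵢ[ℂ] K} (hst : IsStinespringRepresentation A Φ π V E j) :
    IsNormalMap (fun a => π a) := by
  -- The net stays quantified inside the induction: the step for S at π(b) V y uses the hypothesis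
  -- at y for the net Φ(b* s b), whose supremum is Φ(b* a b) by normality of Φ.
  have hE : ∀ n, ∀ (S : Set A) (a : A), S.Nonempty → DirectedOn (· ≤ ·) S →
      (∀ s ∈ S, IsSelfAdjoint s) →
      IsLUB ((fun s : A => (s : H →L[ℂ] H)) '' S) (a : H →L[ℂ] H) →
      ∀ x ∈ E n, ∀ ε > 0, ∃ s ∈ S, (⟪π (a - s) x, x⟫_ℂ).re < ε := by
    intro n
    induction n with
    | zero =>
      intro S a hne hdir hsa hlub x hx ε hε
      rw [← hst.range_zero] at hx
      obtain ⟨y, rfl⟩ := hx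
      obtain ⟨_, ⟨s, hs, rfl⟩, hlt⟩ := exists_re_inner_lt (hne.image _)
        (directedOn_coe_image hdir) hlub y hε
      refine ⟨s, hs, ?_⟩
      change (⟪π (a - s) (j y), j y⟫_ℂ).re < ε
      rw [hst.apply_zero, j.inner_map_map]
      exact hlt
    | succ n ih =>
      intro S a hne hdir hsa hlub x hx
      have hub : ∀ s ∈ S, s ≤ a := fun s hs => hlub.1 ⟨s, hs, rfl⟩
      have hub' : ∀ s ∈ (fun a => π a) '' S, s ≤ π a := by
        rintro _ ⟨s, hs, rfl⟩
        exact starAlgHom_mono π (hub s hs)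
      rw [← hst.minimal n] at hx
      suffices h : ∀ x ∈ {y : K | ∃ a : A, ∃ x ∈ E n, y = π a (V x)}, ∀ ε > 0,
          ∃ s ∈ (fun a => π a) '' S, (⟪(π a - s) x, x⟫_ℂ).re < ε by
        intro ε hε
        obtain ⟨_, ⟨s, hs, rfl⟩, hlt⟩ := re_inner_lt_of_mem_closure_span (hne.image _)
          (directedOn_image_of_monotone (fun _ _ h => starAlgHom_mono π h) hdir) hub' h x hx ε hε
        exact ⟨s, hs, by rwa [map_sub]⟩
      rintro _ ⟨b, y, hy, rfl⟩ ε hε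
      let c : A → A := fun s => star b * s * b
      have hc : Monotone c := fun s t h => star_left_conjugate_le_conjugate h b
      have hΦc : Monotone fun s => Φ (c s) := fun s t h => completelyPositiveMap_mono Φ (hc h)
      have hcsa : ∀ s ∈ S, IsSelfAdjoint (c s) := fun s hs => (hsa s hs).conjugate' b
      have hlub1 : IsLUB ((fun s : A => (s : H →L[ℂ] H)) '' (c '' S)) (c a : H →L[ℂ] H) := by
        have := isLUB_conj (hne.image _) (directedOn_coe_image hdir)
          hlub (b : H →L[ℂ] H)
        rw [Set.image_image] at this ⊢
        exact this
      have hlub2 := hΦ (c '' S) (c a) (hne.image _) (directedOn_image_of_monotone hc hdir)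
        (by rintro _ ⟨s, hs, rfl⟩; exact hcsa s hs) hlub1
      have hlub3 : IsLUB ((fun s : A => (s : H →L[ℂ] H)) '' ((fun s => Φ (c s)) '' S))
          (Φ (c a) : H →L[ℂ] H) := by
        rw [Set.image_image] at hlub2 ⊢
        exact hlub2
      obtain ⟨_, ⟨s, hs, rfl⟩, hlt⟩ := ih ((fun s => Φ (c s)) '' S) (Φ (c a)) (hne.image _)
        (directedOn_image_of_monotone hΦc hdir)
        (by rintro _ ⟨s, hs, rfl⟩; exact (hcsa s hs).map Φ) hlub3 y hy ε hε
      refine ⟨_, ⟨s, hs, rfl⟩, ?_⟩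
      have h : star b * (a - s) * b = c a - c s := by simp only [c, mul_sub, sub_mul]
      rw [← map_sub Φ, ← h, ← hst.covariant, inner_compress, map_mul, map_mul, map_star,
        mul_assoc, mul_apply_eq_comp, star_eq_adjoint, adjoint_inner_left, map_sub] at hlt
      exact hlt
  refine isNormalMap_of_total (X := ⋃ n, (E n : Set K)) ?_ ?_
  · have hc : ∀ n, CompleteSpace (E n) := fun n => by
      cases n with
      | zero =>
        have : IsClosed (E 0 : Set K) := by
          rw [← hst.range_zero]
          exact j.isometry.isClosedEmbedding.isClosed_range
        exact this.completeSpace_coe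
      | succ n =>
        have : IsClosed (E (n + 1) : Set K) := by
          rw [← hst.minimal n]
          exact Submodule.isClosed_topologicalClosure _
        exact this.completeSpace_coe
    have h1 := hst.isHilbertSum.OrthogonalFamily.range_linearIsometry
    rw [LinearMap.range_eq_top.mpr hst.isHilbertSum.surjective_isometry] at h1
    rw [eq_top_iff, h1]
    refine Submodule.topologicalClosure_mono (iSup_le fun n => ?_)
    rintro _ ⟨x, rfl⟩
    exact Submodule.subset_span (Set.mem_iUnion.mpr ⟨n, x.2⟩)
  · intro S a hne hdir hsa hlub x hx
    obtain ⟨n, hn⟩ := Set.mem_iUnion.mp hx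
    exact hE n S a hne hdir hsa hlub x hn

/-- A von Neumann algebra contains the suprema of its bounded increasing nets. -/
theorem exists_isLUB_vonNeumannAlgebra (M : VonNeumannAlgebra H) {S : Set M.toStarSubalgebra}
    (hne : S.Nonempty) (hdir : DirectedOn (· ≤ ·) S) {b : M.toStarSubalgebra}
    (hb : ∀ s ∈ S, s ≤ b) : ∃ m : M.toStarSubalgebra,
      IsLUB ((fun s : M.toStarSubalgebra => (s : H →L[ℂ] H)) '' S) (m : H →L[ℂ] H) := by
  have hne' := hne.image (fun s : M.toStarSubalgebra => (s : H →L[ℂ] H))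
  have hdir' := directedOn_coe_image hdir
  obtain ⟨T, hT⟩ := exists_tendsto_of_directedOn hne' hdir' (b := (b : H →L[ℂ] H))
    (by rintro _ ⟨s, hs, rfl⟩; exact hb s hs)
  have hlub := isLUB_of_tendsto hne' hdir' hT
  refine ⟨⟨T, ?_⟩, hlub⟩
  rw [VonNeumannAlgebra.mem_carrier, ← M.centralizer_centralizer]
  intro t ht
  ext x
  refine eq_of_forall_dist_le fun ε hε => ?_
  obtain ⟨_, ⟨s, hs, rfl⟩, h1, h2⟩ := exists_norm_sub_apply_lt hne' hdir' hlub x (t x)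
    (show 0 < ε / (‖t‖ + 1) by positivity)
  have hcomm : t ((s : H →L[ℂ] H) x) = (s : H →L[ℂ] H) (t x) :=
    (congrArg (fun T : H →L[ℂ] H => T x) (ht s s.2)).symm
  have h3 : (t * T) x - (T * t) x = t ((T - s) x) - (T - s) (t x) := by
    simp only [mul_apply_eq_comp, sub_apply, map_sub, hcomm]
    abel
  rw [dist_eq_norm, h3]
  have h4 : ‖t ((T - s) x)‖ ≤ ‖t‖ * (ε / (‖t‖ + 1)) := (le_opNorm t _).trans (by gcongr)
  have h5 := norm_sub_le (t ((T - s) x)) ((T - s) (t x))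
  have h6 : ‖t‖ * (ε / (‖t‖ + 1)) + ε / (‖t‖ + 1) = ε := by
    have : ‖t‖ + 1 ≠ 0 := by positivity
    field_simp
  linarith

end NormalRepresentations

/-! ### The range of a normal representation is a von Neumann algebra -/

section NormalRange

open ContinuousLinearMap

variable {H K : Type*} [NormedAddCommGroup H] [InnerProductSpace ℂ H] [CompleteSpace H]
  [NormedAddCommGroup K] [InnerProductSpace ℂ K] [CompleteSpace K]

theorem re_inner_conj_eq_norm_sq (x : H →L[ℂ] H) (h : H) :
    (⟪(star x * x) h, h⟫_ℂ).re = ‖x h‖ ^ 2 := by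
  rw [mul_apply_eq_comp, star_eq_adjoint, adjoint_inner_left]
  exact inner_self_eq_norm_sq (𝕜 := ℂ) _

/-- If the positive functional given by `ξ` is dominated by the one given by `h` on the order
interval `[0, w]`, then it is dominated on all of `w M w`. -/
theorem norm_rep_apply_le_of_dominated {A : StarSubalgebra ℂ (H →L[ℂ] H)}
    [IsClosed (A : Set (H →L[ℂ] H))] (π : A →⋆ₐ[ℂ] (K →L[ℂ] K)) {w : A} (hw0 : 0 ≤ w)
    (hw1 : w ≤ 1) {ξ : K} {h : H}
    (hdom : ∀ y : A, 0 ≤ y → y ≤ w → (⟪π y ξ, ξ⟫_ℂ).re ≤ (⟪(y : H →L[ℂ] H) h, h⟫_ℂ).re) (x : A) :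
    ‖π x (π w ξ)‖ ≤ ‖(x : H →L[ℂ] H) ((w : H →L[ℂ] H) h)‖ := by
  have hle : ∀ x : A, ‖x‖ ≤ 1 →
      ‖π x (π w ξ)‖ ≤ ‖(x : H →L[ℂ] H) ((w : H →L[ℂ] H) h)‖ := by
    intro x hx
    -- For a contraction x, (xw)*(xw) = w x* x w ≤ w² ≤ w lies in the interval where domination is
    -- assumed. General x follows by scaling.
    have h1 : star x * x ≤ 1 := by
      rw [← CStarAlgebra.norm_le_one_iff_of_nonneg _ (star_mul_self_nonneg x),
        CStarRing.norm_star_mul_self]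
      nlinarith [norm_nonneg x]
    have h2 : star (x * w) * (x * w) ≤ w := by
      have h3 := star_left_conjugate_le_conjugate h1 w
      rw [mul_one, (IsSelfAdjoint.of_nonneg hw0).star_eq] at h3
      have h4 : w * w ≤ w := by
        simpa [pow_two] using CStarAlgebra.pow_antitone hw0 hw1 (show 1 ≤ 2 by norm_num)
      refine le_trans (le_of_eq ?_) (h3.trans h4)
      rw [star_mul, (IsSelfAdjoint.of_nonneg hw0).star_eq]
      simp only [mul_assoc]
    have h5 := hdom _ (star_mul_self_nonneg (x * w)) h2
    rw [map_mul, map_star, re_inner_conj_eq_norm_sq, MulMemClass.coe_mul, StarMemClass.coe_star,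
      re_inner_conj_eq_norm_sq, map_mul] at h5
    exact le_of_sq_le_sq h5 (norm_nonneg _)
  rcases eq_or_ne x 0 with rfl | hx
  · simp
  have hx' : 0 < ‖x‖ := norm_pos_iff.mpr hx
  have := hle ((‖x‖⁻¹ : ℂ) • x) (by
    rw [norm_smul, norm_inv, Complex.norm_real, norm_norm]
    exact inv_mul_le_one)
  rw [map_smul, SetLike.val_smul, smul_apply, smul_apply, norm_smul, norm_smul] at this
  exact le_of_mul_le_mul_left this (by simpa using hx)

/-- Below a nonzero positive element `c` of a von Neumann algebra, any vector functional of a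
representation is locally dominated by a vector functional. -/
theorem exists_dominated (M : VonNeumannAlgebra H)
    (π : M.toStarSubalgebra →⋆ₐ[ℂ] (K →L[ℂ] K)) (ξ : K) {c : M.toStarSubalgebra} (hc0 : 0 ≤ c)
    (hc1 : c ≤ 1) (hc : c ≠ 0) :
    ∃ (h : H) (w : M.toStarSubalgebra), 0 ≤ w ∧ w ≤ c ∧ w ≠ 0 ∧ ∀ x : M.toStarSubalgebra,
      ‖π x (π w ξ)‖ ≤ ‖(x : H →L[ℂ] H) ((w : H →L[ℂ] H) h)‖ := by
  obtain ⟨h₀, hh₀⟩ : ∃ h₀, 0 < (⟪(c : H →L[ℂ] H) h₀, h₀⟫_ℂ).re := by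
    obtain ⟨d, rfl⟩ := exists_star_mul_self hc0
    have hd : (d : H →L[ℂ] H) ≠ 0 := fun h => hc (by
      rw [show d = 0 from Subtype.ext h]; simp)
    obtain ⟨h₀, hh₀⟩ : ∃ h₀, (d : H →L[ℂ] H) h₀ ≠ 0 := by
      by_contra! h
      exact hd (ContinuousLinearMap.ext h)
    refine ⟨h₀, ?_⟩
    rw [MulMemClass.coe_mul, StarMemClass.coe_star, re_inner_conj_eq_norm_sq]
    positivity
  -- A large multiple of `h₀` makes the functional of h strictly larger at c, so a maximal element
  -- of Y below cannot be c.
  obtain ⟨h, hh⟩ : ∃ h, (⟪π c ξ, ξ⟫_ℂ).re < (⟪(c : H →L[ℂ] H) h, h⟫_ℂ).re := by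
    obtain ⟨n, hn⟩ := exists_nat_gt ((⟪π c ξ, ξ⟫_ℂ).re / (⟪(c : H →L[ℂ] H) h₀, h₀⟫_ℂ).re)
    rw [div_lt_iff₀ hh₀] at hn
    refine ⟨(n : ℂ) • h₀, ?_⟩
    rw [map_smul, inner_smul_left, inner_smul_right, ← mul_assoc, Complex.conj_mul',
      ← Complex.ofReal_pow, Complex.re_ofReal_mul, Complex.norm_natCast]
    refine hn.trans_le ?_
    gcongr
    exact_mod_cast Nat.le_self_pow two_ne_zero n
  -- Y collects the elements where domination is reversed. It is closed under suprema of nonempty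
  -- chains using only monotonicity of π, as the form at h is order continuous. For a maximal y, a
  -- violation of domination at some x in [0, c − y] would put y + x into Y, forcing x = 0; hence w
  -- = c − y works.
  let Y : Set M.toStarSubalgebra := {y | 0 ≤ y ∧ y ≤ c ∧
    (⟪(y : H →L[ℂ] H) h, h⟫_ℂ).re ≤ (⟪π y ξ, ξ⟫_ℂ).re}
  have h0Y : 0 ∈ Y := ⟨le_rfl, hc0, by simp⟩
  obtain ⟨y, -, ⟨hyY, hmax⟩⟩ := zorn_le_nonempty₀ Y (fun C hCY hC y₀ hy₀ => by
    obtain ⟨m, hm⟩ := exists_isLUB_vonNeumannAlgebra M ⟨y₀, hy₀⟩ hC.directedOn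
      (fun s hs => (hCY hs).2.1)
    have hub : ∀ s ∈ C, s ≤ m := fun s hs => hm.1 ⟨s, hs, rfl⟩
    refine ⟨m, ⟨(hCY hy₀).1.trans (hub y₀ hy₀), ?_, ?_⟩, hub⟩
    · exact hm.2 (by rintro _ ⟨s, hs, rfl⟩; exact (hCY hs).2.1)
    · refine le_of_forall_pos_lt_add fun ε hε => ?_
      obtain ⟨_, ⟨s, hs, rfl⟩, hlt⟩ := exists_re_inner_lt (Set.Nonempty.image _ ⟨y₀, hy₀⟩)
        (directedOn_coe_image hC.directedOn) hm h hε
      have h1 := re_inner_mono (starAlgHom_mono π (hub s hs)) ξ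
      have h2 := (hCY hs).2.2
      rw [sub_apply, inner_sub_left, Complex.sub_re] at hlt
      linarith) 0 h0Y
  have hyc : y ≤ c := hyY.2.1
  refine ⟨h, c - y, sub_nonneg.mpr hyc, sub_le_self c hyY.1, fun h0 => ?_, ?_⟩
  · rw [sub_eq_zero.mp h0] at hh
    exact absurd hyY.2.2 (not_le.mpr hh)
  refine norm_rep_apply_le_of_dominated π (sub_nonneg.mpr hyc) ((sub_le_self c hyY.1).trans hc1) ?_
  intro x hx0 hxw
  by_contra! hlt
  have hxy : y + x ∈ Y := by
    refine ⟨add_nonneg hyY.1 hx0, by rw [add_comm]; exact le_sub_iff_add_le.mp hxw, ?_⟩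
    have := hyY.2.2
    rw [map_add, AddMemClass.coe_add, add_apply, add_apply, inner_add_left, inner_add_left,
      Complex.add_re, Complex.add_re]
    linarith
  have hx : x = 0 := le_antisymm (by simpa using hmax hxy (le_add_of_nonneg_right hx0)) hx0
  rw [hx] at hlt
  simp at hlt

variable {M : VonNeumannAlgebra H} {π : M.toStarSubalgebra →⋆ₐ[ℂ] (K →L[ℂ] K)}
  {j : H →ₗᵢ[ℂ] K}

/-- For fixed ξ, take a maximal z in [0, 1] with S π(z) ξ = 0; normality of π lets chains pass to
their suprema. If z ≠ 1, local domination below 1 − z supplies a nonzero w with S π(w) ξ = 0,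
contradicting maximality of z. -/
theorem eq_zero_of_mem_centralizer_centralizer
    (hj : ∀ (a : M.toStarSubalgebra) (x : H), π a (j x) = j ((a : H →L[ℂ] H) x))
    (hn : IsNormalMap (fun a => π a)) {S : K →L[ℂ] K}
    (hS : S ∈ Set.centralizer (Set.centralizer (π.range : Set (K →L[ℂ] K))))
    (hSj : ∀ x, S (j x) = 0) : S = 0 := by
  ext ξ
  let Y : Set M.toStarSubalgebra := {y | 0 ≤ y ∧ y ≤ 1 ∧ S (π y ξ) = 0}
  have h0Y : 0 ∈ Y := ⟨le_rfl, zero_le_one, by simp⟩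
  obtain ⟨z, -, ⟨hzY, hmax⟩⟩ := zorn_le_nonempty₀ Y (fun C hCY hC y₀ hy₀ => by
    have hne : C.Nonempty := ⟨y₀, hy₀⟩
    obtain ⟨m, hm⟩ := exists_isLUB_vonNeumannAlgebra M hne hC.directedOn
      (fun s hs => (hCY hs).2.1)
    have hub : ∀ s ∈ C, s ≤ m := fun s hs => hm.1 ⟨s, hs, rfl⟩
    refine ⟨m, ⟨(hCY hy₀).1.trans (hub y₀ hy₀), ?_, ?_⟩, hub⟩
    · exact hm.2 (by rintro _ ⟨s, hs, rfl⟩; exact (hCY hs).2.1)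
    · have hlub := hn C m hne hC.directedOn (fun s hs => IsSelfAdjoint.of_nonneg (hCY hs).1) hm
      rw [← norm_le_zero_iff]
      refine le_of_forall_pos_lt_add fun ε hε => ?_
      obtain ⟨_, ⟨s, hs, rfl⟩, hlt, -⟩ := exists_norm_sub_apply_lt (hne.image _)
        (directedOn_image_of_monotone (fun _ _ h => starAlgHom_mono π h) hC.directedOn) hlub ξ ξ
        (show 0 < ε / (‖S‖ + 1) by positivity)
      have h1 : S (π m ξ) = S ((π m - π s) ξ) := by
        rw [sub_apply, map_sub, (hCY hs).2.2, sub_zero]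
      rw [lt_div_iff₀ (by positivity)] at hlt
      rw [h1, zero_add]
      refine (le_opNorm _ _).trans_lt ?_
      nlinarith [norm_nonneg ((π m - π s) ξ)]) 0 h0Y
  by_cases hz : z = 1
  · simpa [hz] using hzY.2.2
  exfalso
  obtain ⟨h, w, hw0, hwc, hw, hle⟩ := exists_dominated M π ξ (sub_nonneg.mpr hzY.2.1)
    (sub_le_self 1 hzY.1) (sub_ne_zero.mpr (Ne.symm hz))
  have hSw : S (π w ξ) = 0 := by
    rw [← norm_le_zero_iff]
    refine le_of_forall_pos_lt_add fun ε hε => ?_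
    -- Approximate S by π(x) at both j(w h) and π(w) ξ. As S vanishes at the first vector, x w h is
    -- small; domination makes π(x) π(w) ξ small, hence also S π(w) ξ.
    obtain ⟨_, ⟨x, rfl⟩, h1, h2⟩ := exists_approx_of_mem_centralizer_centralizer π.range hS
      (j ((w : H →L[ℂ] H) h)) (π w ξ) (half_pos hε)
    change ‖(S - π x) (j ((w : H →L[ℂ] H) h))‖ < _ at h1
    change ‖(S - π x) (π w ξ)‖ < _ at h2
    rw [sub_apply, hSj, hj, zero_sub, norm_neg, j.norm_map] at h1
    have h3 := hle x
    have h4 : S (π w ξ) = (S - π x) (π w ξ) + π x (π w ξ) := by simp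
    have h5 := norm_add_le ((S - π x) (π w ξ)) (π x (π w ξ))
    rw [h4]
    linarith
  have hzw : z + w ∈ Y := by
    refine ⟨add_nonneg hzY.1 hw0, by rw [add_comm]; exact le_sub_iff_add_le.mp hwc, ?_⟩
    rw [map_add, add_apply, map_add, hzY.2.2, hSw, add_zero]
  exact hw (le_antisymm (by simpa using hmax hzw (le_add_of_nonneg_right hw0)) hw0)

/-- The range of a normal representation that contains the identity representation is a
von Neumann algebra. -/
theorem mem_range_of_mem_centralizer_centralizer
    (hj : ∀ (a : M.toStarSubalgebra) (x : H), π a (j x) = j ((a : H →L[ℂ] H) x))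
    (hn : IsNormalMap (fun a => π a)) {T : K →L[ℂ] K}
    (hT : T ∈ Set.centralizer (Set.centralizer (π.range : Set (K →L[ℂ] K)))) : T ∈ π.range := by
  have hj' : ∀ (a : M.toStarSubalgebra) (y : K), adjoint j.toContinuousLinearMap (π a y) =
      (a : H →L[ℂ] H) (adjoint j.toContinuousLinearMap y) := fun a y => by
    refine ext_inner_left ℂ fun x => ?_
    rw [adjoint_inner_right, ← adjoint_inner_left (a : H →L[ℂ] H), adjoint_inner_right,
      ← adjoint_inner_left (π a), ← star_eq_adjoint, ← star_eq_adjoint, ← map_star]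
    exact congrArg (⟪·, y⟫_ℂ) (hj (star a) x)
  have hjj : ∀ x, adjoint j.toContinuousLinearMap (j x) = x := fun x =>
    congrArg (fun T : H →L[ℂ] H => T x) (adjoint_backShift_comp_self (U := 1) (Z := j) 0)
  have hcent : ∀ t ∈ Set.centralizer (M : Set (H →L[ℂ] H)),
      inflate j t ∈ Set.centralizer (π.range : Set (K →L[ℂ] K)) := by
    rintro t ht _ ⟨a, rfl⟩
    ext y
    have h1 := congrArg (fun T : H →L[ℂ] H => T (adjoint j.toContinuousLinearMap y)) (ht a a.2)
    change π a (j (t (adjoint j.toContinuousLinearMap y))) =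
      j (t (adjoint j.toContinuousLinearMap (π a y)))
    rw [hj, hj']
    exact congrArg j h1
  have hTc : ∀ t ∈ Set.centralizer (M : Set (H →L[ℂ] H)), ∀ y,
      j (t (adjoint j.toContinuousLinearMap (T y))) =
        T (j (t (adjoint j.toContinuousLinearMap y))) := fun t ht y =>
    congrArg (fun T : K →L[ℂ] K => T y) (hT _ (hcent t ht))
  have ha : compress j T ∈ M.toStarSubalgebra := by
    rw [VonNeumannAlgebra.mem_carrier, ← M.centralizer_centralizer]
    intro t ht
    ext x
    have h1 := hTc t ht (j x)
    rw [hjj] at h1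
    change t (adjoint j.toContinuousLinearMap (T (j x))) =
      adjoint j.toContinuousLinearMap (T (j (t x)))
    rw [← h1, hjj]
  let a : M.toStarSubalgebra := ⟨compress j T, ha⟩
  have hS : T - π a ∈ Set.centralizer (Set.centralizer (π.range : Set (K →L[ℂ] K))) := by
    intro t ht
    have h1 : π a * t = t * π a := ht _ ⟨a, rfl⟩
    rw [mul_sub, sub_mul, hT t ht, h1]
  have hzero := eq_zero_of_mem_centralizer_centralizer hj hn hS fun x => by
    -- The case t = 1 says that T commutes with the projection j j*, so T maps jH into itself and
    -- agrees there with π(j* T j).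
    have h1 := hTc 1 (fun m _ => by rw [mul_one, one_mul]) (j x)
    rw [hjj] at h1
    rw [sub_apply, hj, sub_eq_zero]
    exact h1.symm
  exact ⟨a, (sub_eq_zero.mp hzero).symm⟩

end NormalRange

/-! ### Passage to the double commutant -/

section VonNeumannDilation

open ContinuousLinearMap

variable {H K L : Type*} [NormedAddCommGroup H] [InnerProductSpace ℂ H] [CompleteSpace H]
  [NormedAddCommGroup K] [InnerProductSpace ℂ K] [CompleteSpace K]
  [NormedAddCommGroup L] [InnerProductSpace ℂ L] [CompleteSpace L]

/-- The von Neumann algebra generated by a *-algebra of operators. -/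
noncomputable def doubleCommutant (B : StarSubalgebra ℂ (L →L[ℂ] L)) : VonNeumannAlgebra L where
  toStarSubalgebra := StarSubalgebra.centralizer ℂ
    (StarSubalgebra.centralizer ℂ (B : Set (L →L[ℂ] L)) : Set (L →L[ℂ] L))
  centralizer_centralizer' := by simp

theorem mem_doubleCommutant {B : StarSubalgebra ℂ (L →L[ℂ] L)} {X : L →L[ℂ] L} :
    X ∈ (doubleCommutant B).toStarSubalgebra ↔
      X ∈ Set.centralizer (Set.centralizer (B : Set (L →L[ℂ] L))) := by
  have h : ∀ C : StarSubalgebra ℂ (L →L[ℂ] L),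
      (StarSubalgebra.centralizer ℂ (C : Set (L →L[ℂ] L)) : Set (L →L[ℂ] L)) =
        Set.centralizer (C : Set (L →L[ℂ] L)) := fun C => by
    rw [StarSubalgebra.coe_centralizer, StarMemClass.star_coe_eq, Set.union_self]
  change X ∈ (StarSubalgebra.centralizer ℂ
    (StarSubalgebra.centralizer ℂ (B : Set (L →L[ℂ] L)) : Set (L →L[ℂ] L)) : Set (L →L[ℂ] L)) ↔ _
  rw [h, h]

theorem le_doubleCommutant (B : StarSubalgebra ℂ (L →L[ℂ] L)) :
    B ≤ (doubleCommutant B).toStarSubalgebra := fun _ hX =>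
  mem_doubleCommutant.mpr (Set.subset_centralizer_centralizer hX)

/-- If T commutes with B, then U T U* does too, because U* B U ⊆ B. So X commutes with U T U*, and
conjugating back gives the claim; only this one inclusion is used. -/
theorem conj_mem_doubleCommutant {B : StarSubalgebra ℂ (L →L[ℂ] L)} (U : unitary (L →L[ℂ] L))
    (hB : ∀ X ∈ B, star (U : L →L[ℂ] L) * X * U ∈ B) {X : L →L[ℂ] L}
    (hX : X ∈ (doubleCommutant B).toStarSubalgebra) :
    star (U : L →L[ℂ] L) * X * U ∈ (doubleCommutant B).toStarSubalgebra := by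
  have h1 : star (U : L →L[ℂ] L) * U = 1 := Unitary.coe_star_mul_self U
  have h2 : (U : L →L[ℂ] L) * star (U : L →L[ℂ] L) = 1 := Unitary.coe_mul_star_self U
  rw [mem_doubleCommutant] at hX ⊢
  have key : ∀ R T : L →L[ℂ] L, U * (star (U : L →L[ℂ] L) * R * U * T) * star (U : L →L[ℂ] L) =
      R * (U * T * star (U : L →L[ℂ] L)) := fun R T => by
    simp only [← mul_assoc, h2, one_mul]
  have key' : ∀ R T : L →L[ℂ] L, U * (T * (star (U : L →L[ℂ] L) * R * U)) * star (U : L →L[ℂ] L) =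
      (U * T * star (U : L →L[ℂ] L)) * R := fun R T => by
    simp only [mul_assoc, h2, mul_one]
  have hcancel : ∀ R T : L →L[ℂ] L,
      U * R * star (U : L →L[ℂ] L) = U * T * star (U : L →L[ℂ] L) → R = T := fun R T h => by
    have := congrArg (fun Q => star (U : L →L[ℂ] L) * Q * U) h
    simpa only [mul_assoc, h1, mul_one, ← mul_assoc (star _) (U : L →L[ℂ] L), one_mul] using this
  intro T hT
  refine hcancel _ _ ?_
  rw [key, key']
  refine hX _ fun Y hY => ?_
  have h3 := congrArg (fun Q => U * Q * star (U : L →L[ℂ] L)) (hT _ (hB Y hY))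
  simp only [key, key'] at h3
  exact h3

/-- To test commutation of Z* X Z with T at a vector x, X must be approximated at Z x and Z(T x)
simultaneously, which is why density is needed for two vectors. -/
theorem compress_mem_centralizer_centralizer {B : StarSubalgebra ℂ (L →L[ℂ] L)}
    {C : Set (K →L[ℂ] K)} {Z : K →ₗᵢ[ℂ] L} (hB : ∀ Y ∈ B, compress Z Y ∈ C) {X : L →L[ℂ] L}
    (hX : X ∈ (doubleCommutant B).toStarSubalgebra) :
    compress Z X ∈ Set.centralizer (Set.centralizer C) := by
  rw [mem_doubleCommutant] at hX
  intro T hT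
  ext x
  refine eq_of_forall_dist_le fun ε hε => ?_
  obtain ⟨Y, hY, h1, h2⟩ := exists_approx_of_mem_centralizer_centralizer B hX (Z x) (Z (T x))
    (show 0 < ε / (‖T‖ + 1) by positivity)
  have hle : ∀ x, ‖compress Z X x - compress Z Y x‖ ≤ ‖(X - Y) (Z x)‖ := fun x => by
    have h : compress Z X x - compress Z Y x =
        adjoint Z.toContinuousLinearMap ((X - Y) (Z x)) := by
      rw [sub_apply, map_sub]
      rfl
    rw [h]
    refine (le_opNorm _ _).trans ?_
    rw [LinearIsometryEquiv.norm_map]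
    exact mul_le_of_le_one_left (norm_nonneg _) Z.norm_toContinuousLinearMap_le
  have hcomm : T (compress Z Y x) = compress Z Y (T x) :=
    (congrArg (fun T : K →L[ℂ] K => T x) (hT _ (hB Y hY))).symm
  have h3 : (T * compress Z X) x - (compress Z X * T) x =
      T (compress Z X x - compress Z Y x) - (compress Z X (T x) - compress Z Y (T x)) := by
    simp only [mul_apply_eq_comp, map_sub, hcomm]
    abel
  rw [dist_eq_norm, h3]
  have h4 : ‖T (compress Z X x - compress Z Y x)‖ ≤ ‖T‖ * (ε / (‖T‖ + 1)) :=
    (le_opNorm T _).trans (by gcongr; exact (hle x).trans h1.le)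
  have h5 := norm_sub_le (T (compress Z X x - compress Z Y x))
    (compress Z X (T x) - compress Z Y (T x))
  have h6 : ‖T‖ * (ε / (‖T‖ + 1)) + ε / (‖T‖ + 1) = ε := by
    have : ‖T‖ + 1 ≠ 0 := by positivity
    field_simp
  have h7 := hle (T x)
  linarith

theorem isNormalMap_conj {B : StarSubalgebra ℂ (L →L[ℂ] L)} {Θ : B →⋆ₐ[ℂ] B}
    {U : unitary (L →L[ℂ] L)}
    (hΘ : ∀ X : B, (Θ X : L →L[ℂ] L) = star (U : L →L[ℂ] L) * X * (U : L →L[ℂ] L)) :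
    IsNormalMap (fun X => (Θ X : L →L[ℂ] L)) := by
  intro S a hne hdir _ hlub
  have := isLUB_conj (hne.image _) (directedOn_coe_image hdir) hlub (U : L →L[ℂ] L)
  rw [Set.image_image] at this
  simpa only [hΘ] using this

end VonNeumannDilation

/-- The spaces, π, V, U and Z are constructed as in the C*-case; only the algebra is enlarged, to
the double commutant of the generated *-algebra. -/
theorem exists_vonNeumann_dilation {H : Type u} [NormedAddCommGroup H] [InnerProductSpace ℂ H]
    [CompleteSpace H] (M : VonNeumannAlgebra H) (Φ : M.toStarSubalgebra →CP M.toStarSubalgebra)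
    (hΦ : Φ 1 = 1) (hn : IsNormalMap (fun a => (Φ a : H →L[ℂ] H))) :
      ∃ (K : Type u) (_ : NormedAddCommGroup K) (_ : InnerProductSpace ℂ K) (_ : CompleteSpace K)
        (π : M.toStarSubalgebra →⋆ₐ[ℂ] (K →L[ℂ] K)) (V : K →ₗᵢ[ℂ] K) (E : ℕ → Submodule ℂ K)
        (j : H →ₗᵢ[ℂ] K)
        (K' : Type u) (_ : NormedAddCommGroup K') (_ : InnerProductSpace ℂ K')
        (_ : CompleteSpace K') (U : unitary (K' →L[ℂ] K')) (Z : K →ₗᵢ[ℂ] K')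
        (N : VonNeumannAlgebra K') (Θ : N.toStarSubalgebra →⋆ₐ[ℂ] N.toStarSubalgebra),
        Function.Injective π ∧ IsNormalMap π ∧
        IsStinespringRepresentation M.toStarSubalgebra Φ π V E j ∧
        IsMinimalUnitaryDilation V U Z ∧
        IsNormalMap (fun X => (Θ X : K' →L[ℂ] K')) ∧
        (∀ X : N.toStarSubalgebra,
          (Θ X : K' →L[ℂ] K') = star (U : K' →L[ℂ] K') * X * (U : K' →L[ℂ] K')) ∧
        IsMultiplicativeDilation Φ π Θ Z := by
  obtain ⟨K, _, _, _, π, V, E, j, hst⟩ := exists_isStinespringRepresentation Φ hΦ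
  obtain ⟨K', _, _, _, U, Z, hdil⟩ := exists_isMinimalUnitaryDilation V
  have hπn := isNormalMap_of_isStinespringRepresentation hn hst
  let B := StarAlgebra.adjoin ℂ (dilationGenerators π U Z)
  obtain ⟨Θ, hΘ⟩ := exists_conj_starAlgHom U (doubleCommutant B).toStarSubalgebra
    fun X hX => conj_mem_doubleCommutant U (fun X hX => conj_mem_adjoin hX) hX
  refine ⟨K, _, _, ‹_›, π, V, E, j, K', _, _, ‹_›, U, Z, doubleCommutant B, Θ,
    injective_of_isStinespringRepresentation hst, hπn, hst, hdil, isNormalMap_conj hΘ, hΘ, ?_⟩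
  refine isMultiplicativeDilation hst.covariant hdil ?_ (fun X hX => ?_) Θ hΘ
  · exact fun X hX => le_doubleCommutant B (StarAlgebra.subset_adjoin _ _ hX)
  · exact mem_range_of_mem_centralizer_centralizer hst.apply_zero hπn
      (compress_mem_centralizer_centralizer
        (fun Y hY => compress_mem_range hst.covariant hdil hY) hX)

end UcpDilation

theorem mainTheorem3 :
    (∀ (H : Type u) [NormedAddCommGroup H] [InnerProductSpace ℂ H] [CompleteSpace H]
        (A : StarSubalgebra ℂ (H →L[ℂ] H)) [IsClosed (A : Set (H →L[ℂ] H))]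
        (Φ : A →CP A), Φ 1 = 1 →
      ∃ (K : Type u) (_ : NormedAddCommGroup K) (_ : InnerProductSpace ℂ K) (_ : CompleteSpace K)
        (π : A →⋆ₐ[ℂ] (K →L[ℂ] K)) (V : K →ₗᵢ[ℂ] K) (E : ℕ → Submodule ℂ K) (j : H →ₗᵢ[ℂ] K)
        (K' : Type u) (_ : NormedAddCommGroup K') (_ : InnerProductSpace ℂ K')
        (_ : CompleteSpace K') (U : unitary (K' →L[ℂ] K')) (Z : K →ₗᵢ[ℂ] K')
        (B : StarSubalgebra ℂ (K' →L[ℂ] K')) (Θ : B →⋆ₐ[ℂ] B),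
        Function.Injective π ∧
        UcpDilation.IsStinespringRepresentation A Φ π V E j ∧
        UcpDilation.IsMinimalUnitaryDilation V U Z ∧
        IsClosed (B : Set (K' →L[ℂ] K')) ∧
        (∀ X : B, (Θ X : K' →L[ℂ] K') = star (U : K' →L[ℂ] K') * X * (U : K' →L[ℂ] K')) ∧
        UcpDilation.IsMultiplicativeDilation Φ π Θ Z) ∧
    (∀ (H : Type u) [NormedAddCommGroup H] [InnerProductSpace ℂ H] [CompleteSpace H]
        (M : VonNeumannAlgebra H) (Φ : M.toStarSubalgebra →CP M.toStarSubalgebra), Φ 1 = 1 →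
        UcpDilation.IsNormalMap (fun a => (Φ a : H →L[ℂ] H)) →
      ∃ (K : Type u) (_ : NormedAddCommGroup K) (_ : InnerProductSpace ℂ K) (_ : CompleteSpace K)
        (π : M.toStarSubalgebra →⋆ₐ[ℂ] (K →L[ℂ] K)) (V : K →ₗᵢ[ℂ] K) (E : ℕ → Submodule ℂ K)
        (j : H →ₗᵢ[ℂ] K)
        (K' : Type u) (_ : NormedAddCommGroup K') (_ : InnerProductSpace ℂ K')
        (_ : CompleteSpace K') (U : unitary (K' →L[ℂ] K')) (Z : K →ₗᵢ[ℂ] K')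
        (N : VonNeumannAlgebra K') (Θ : N.toStarSubalgebra →⋆ₐ[ℂ] N.toStarSubalgebra),
        Function.Injective π ∧ UcpDilation.IsNormalMap π ∧
        UcpDilation.IsStinespringRepresentation M.toStarSubalgebra Φ π V E j ∧
        UcpDilation.IsMinimalUnitaryDilation V U Z ∧
        UcpDilation.IsNormalMap (fun X => (Θ X : K' →L[ℂ] K')) ∧
        (∀ X : N.toStarSubalgebra,
          (Θ X : K' →L[ℂ] K') = star (U : K' →L[ℂ] K') * X * (U : K' →L[ℂ] K')) ∧
        UcpDilation.IsMultiplicativeDilation Φ π Θ Z) := by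
  exact ⟨fun H _ _ _ A _ Φ hΦ => UcpDilation.exists_cstar_dilation A Φ hΦ,
    fun H _ _ _ M Φ hΦ hn => UcpDilation.exists_vonNeumann_dilation M Φ hΦ hn⟩
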